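/- Let $d\ge 1$ and $L\ge 2$ be integers. The hierarchical lattice $\mathbb{H}_L^d$ is the abelian group $\bigoplus_{i=1}^\infty(\mathbb{Z}/L\mathbb{Z})^d$ with the ultrametric $\|x-y\|:=L^{\max\{i:\,x_i\ne y_i\}}$ for $x\neq y$ (and $\|x-x\|:=0$). Its edges are all unordered pairs $e=\{x,y\}$ with $x\ne y$, and $|e|:=\|x-y\|$. Given $q\in[0,1]$ and a kernel $J$, that is, a function from the set of edges to $[0,\infty)$, site-bond percolation $\mathbb{P}_{q,J}$ is the random graph in which each vertex is included (open) independently with probability $q$ and, independently, each edge $e$ between open vertices is included independently with probability $1-\exp(-J(e))$. Let $K_0$ be the cluster of the origin, i.e. the connected component of $0$ in this random graph (empty if $0$ is not open). **Theorem.** For all integers $L\ge2$, $d\ge1$ and every real $a>1$ there exist $q\in(0,1)$ and integers $N_0,N_1\ge 1$ such that the function $$J(e)=\begin{cases}\dfrac{a\,L^d\,\log\log |e|}{|e|^{2d}} & \text{if } |e|\ge N_1,\\[2mm] N_0 & \text{if } |e|<N_1,\end{cases}$$ is a kernel (that is, it takes values in $[0,\infty)$) and $$\mathbb{P}_{q,J}\bigl(|K_0|=\infty\bigr)>0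 .$$ -/

import Mathlib

open MeasureTheory ProbabilityTheory
open scoped NNReal unitInterval

/-- The hierarchical lattice `⨁_{i ≥ 1} (ℤ/Lℤ)^d`, as an abelian group. The Lean coordinate `i : ℕ`
is the coordinate `i + 1` of the usual indexing by the positive integers. -/
abbrev HierLattice (L d : ℕ) : Type := ℕ →₀ (Fin d → ZMod L)

/-- The hierarchical ultrametric: `‖x - y‖ = L ^ max {i ≥ 1 : x_i ≠ y_i}` for distinct `x`, `y`, and
`0` for `x = y`. The finite set `x.neLocus y` consists of the Lean coordinates at which `x` and `y`
differ. -/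
def hierDist {L d : ℕ} (x y : HierLattice L d) : ℕ :=
  if x = y then 0 else L ^ (x.neLocus y).sup (fun i => i + 1)

theorem hierDist_comm {L d : ℕ} (x y : HierLattice L d) : hierDist x y = hierDist y x := by
  unfold hierDist
  rw [Finsupp.neLocus_comm]
  simp only [eq_comm]

/-- The potential edges on a vertex set `V`: the unordered pairs `{x, y}` with `x ≠ y`. -/
abbrev Edge (V : Type) : Type := {e : Sym2 V // ¬ e.IsDiag}

/-- The length `|e| = ‖x - y‖` of an edge `e = {x, y}` of the hierarchical lattice. -/
def edgeLength {L d : ℕ} (e : Edge (HierLattice L d)) : ℕ :=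
  Sym2.lift ⟨hierDist, hierDist_comm⟩ e.1

/-- The probability `1 - exp (-j)`, for `j ≥ 0`. -/
noncomputable def openProb (j : ℝ≥0) : I :=
  ⟨1 - Real.exp (-(j : ℝ)),
    sub_nonneg.2 (Real.exp_le_one_iff.2 (neg_nonpos.2 j.2)),
    sub_le_self 1 (Real.exp_pos _).le⟩

/-- A site-bond configuration: the states of all vertices and of all potential edges (`true` means
open). -/
abbrev SiteBondConfig (V : Type) : Type := (V → Bool) × (Edge V → Bool)

/-- The law of site-bond percolation with vertex density `q` and kernel `J`: every vertex is open
with probability `q`, every potential edge `e` is open with probability `1 - exp (-J e)`, and all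
these states are independent. -/
noncomputable def siteBondMeasure {V : Type} (q : I) (J : Edge V → ℝ≥0) :
    Measure (SiteBondConfig V) :=
  (Measure.infinitePi fun _ : V => bernoulliMeasure true false q).prod
    (Measure.infinitePi fun e : Edge V => bernoulliMeasure true false (openProb (J e)))

/-- The random graph of a site-bond configuration: two distinct vertices are adjacent when both of
them are open and the edge between them is open. -/
def openGraph {V : Type} (ω : SiteBondConfig V) : SimpleGraph V where
  Adj x y := ω.1 x = true ∧ ω.1 y = true ∧
    ∃ h : ¬ (s(x, y) : Sym2 V).IsDiag, ω.2 ⟨s(x, y), h⟩ = true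
  symm := ⟨by
    rintro x y ⟨hx, hy, h, he⟩
    have hs : (s(x, y) : Sym2 V) = s(y, x) := Sym2.eq_swap
    refine ⟨hy, hx, hs ▸ h, ?_⟩
    simpa only [hs] using he⟩
  loopless := ⟨by
    rintro x ⟨_, _, h, _⟩
    exact h (Sym2.mk_isDiag_iff.2 rfl)⟩

/-- The cluster `K_x` of the vertex `x`: the set of all vertices that are joined to `x` by a path in
the random graph. It is empty if `x` is closed. -/
def openCluster {V : Type} (ω : SiteBondConfig V) (x : V) : Set V :=
  {y | ω.1 x = true ∧ (openGraph ω).Reachable x y}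

/-! Put `N = L ^ d` and say that an edge has level `l` if its length is `L ^ l`; far out, `J` at
level `l` is about `a log l · N / N ^ (2 l)`. In units of `N / N ^ (2 l)` per bond, the bonds
leaving a `j`-ball weigh `∑_{i ≥ j} (1 - 1/N) N ^ (j - i) = 1` in total. At intensity `b log n`,
isolating a ball therefore has probability `n ^ (-b)`, and `b > 1` beats a union over `n` levels.
This is where `a > 1` enters.

Outer iteration (`exists_large_cluster`). Suppose that most `n`-balls contain a connected core of
`M` points, with `M` close to `N ^ n`. Regard balls as sites, open if they have a core, and join two
of them if some bond between their cores is open. Given the states inside the balls, the cores are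
fixed and the bonds between them are fresh, so this is again independent site-bond percolation on
the same tree, with kernel `M ^ 2 * J (n + j)` (`Perc.renormalize`). For `1 ≤ j ≤ n` it is at least
`b log n · N / N ^ (2 j)` with some `b > 1`. If sites are closed with probability at most `n ^
(-c)`, then `exists_block` produces cores of density `1 - n ^ (-c/2)` in the coarse `n`-balls, which
are the original `2n`-balls, up to probability `(2n) ^ (-c)`. So the step repeats with `2n`. The
losses in density and in the probability of keeping the origin are summable along `n = 2 ^ m n₀`,
and small for large `n₀`. The start is forced by `q` near `1` and large `N₀`, which open everything
inside an `n₀`-ball with high probability.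

Inside a block (`Perc.real_untainted_not_isBig_le`), induction on the level shows that a point with
no closed site nearby very likely lies in a cluster filling most of its ball. If `j` is the last
level at which this holds, coarsen at level `j - s` for a constant `s`. The coarse cluster starts
with density near `1` but stays below `1 - ε` afterwards. By the isoperimetric step
`closedWeight_step`, each level then contributes closed weight at least the drop in density, and at
least half the minimum of the density and its complement, up to small errors. Within a constant
number `K` of levels the total is nearly `1`, whether the density collapses or stays intermediate.
The loss has probability below about `n ^ (-1-ε)`, since after coarsening only a bounded number of
bonds enters the union bound. The last `K` levels leave only a shorter window and a weaker bound,
but there are boundedly many of them. -/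

noncomputable section

open scoped Classical

/-! ### Trees at infinity and their balls -/

/-- A tree at infinity: the map `up` sends a point to its parent, every point has exactly `N`
children, and any two points have a common ancestor. -/
structure HTree (V : Type) (N : ℕ) where
  up : V → V
  ch : V → Finset V
  mem_ch : ∀ x y, x ∈ ch y ↔ up x = y
  card_ch : ∀ y, (ch y).card = N
  exists_meet : ∀ x y, ∃ n, up^[n] x = up^[n] y

namespace HTree

variable {V : Type} {N : ℕ} (T : HTree V N)

/-- The points whose `n`-th ancestor is `y`. -/
def ball : ℕ → V → Finset V
  | 0, y => {y}
  | n + 1, y => (T.ch y).biUnion (ball n)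

theorem mem_ball {n : ℕ} {x y : V} : x ∈ T.ball n y ↔ T.up^[n] x = y := by
  induction n generalizing y with
  | zero => simp [ball]
  | succ n ih =>
    simp only [ball, Finset.mem_biUnion, ih, T.mem_ch, Function.iterate_succ_apply']
    constructor
    · rintro ⟨z, hz, rfl⟩; exact hz
    · intro h; exact ⟨_, h, rfl⟩

theorem mem_ball_self (n : ℕ) (x : V) : x ∈ T.ball n (T.up^[n] x) := T.mem_ball.2 rfl

theorem card_ball (n : ℕ) (y : V) : (T.ball n y).card = N ^ n := by
  induction n generalizing y with
  | zero => simp [ball]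
  | succ n ih =>
    rw [ball, Finset.card_biUnion]
    · simp [ih, T.card_ch, pow_succ, mul_comm]
    · intro a _ b _ hab
      rw [Function.onFun, Finset.disjoint_left]
      intro x hx hx'
      exact hab ((T.mem_ball.1 hx).symm.trans (T.mem_ball.1 hx'))

theorem ball_add (m n : ℕ) (z : V) : (T.ball m z).biUnion (T.ball n) = T.ball (n + m) z := by
  ext x
  simp only [Finset.mem_biUnion, mem_ball]
  constructor
  · rintro ⟨y, hy, rfl⟩
    rw [add_comm, Function.iterate_add_apply]; exact hy
  · intro h
    exact ⟨_, by rwa [add_comm, Function.iterate_add_apply] at h, rfl⟩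

theorem ball_disjoint {n : ℕ} {y y' : V} (h : y ≠ y') : Disjoint (T.ball n y) (T.ball n y') := by
  rw [Finset.disjoint_left]
  intro x hx hx'
  exact h ((T.mem_ball.1 hx).symm.trans (T.mem_ball.1 hx'))

theorem up_add (m n : ℕ) (x : V) : T.up^[m] (T.up^[n] x) = T.up^[n + m] x := by
  rw [add_comm, Function.iterate_add_apply]

theorem ball_mono {i j : ℕ} (h : i ≤ j) (x : V) :
    T.ball i (T.up^[i] x) ⊆ T.ball j (T.up^[j] x) := by
  intro y hy
  obtain ⟨k, rfl⟩ := Nat.exists_eq_add_of_le h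
  rw [mem_ball] at *
  rw [← T.up_add k i, ← T.up_add k i, hy]

/-- The height of the lowest common ancestor. -/
def lev (x y : V) : ℕ := Nat.find (T.exists_meet x y)

theorem lev_le_iff {x y : V} {n : ℕ} : T.lev x y ≤ n ↔ T.up^[n] x = T.up^[n] y := by
  constructor
  · intro h
    have h1 : T.up^[T.lev x y] x = T.up^[T.lev x y] y := Nat.find_spec (T.exists_meet x y)
    obtain ⟨k, rfl⟩ := Nat.exists_eq_add_of_le h
    rw [← T.up_add, ← T.up_add, h1]
  · intro h; exact Nat.find_min' _ h

theorem lev_comm (x y : V) : T.lev x y = T.lev y x :=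
  le_antisymm (T.lev_le_iff.2 (T.lev_le_iff.1 le_rfl).symm)
    (T.lev_le_iff.2 (T.lev_le_iff.1 le_rfl).symm)

/-- Merging the `n`-balls into points yields the same tree with all levels lowered by `n`; this is
the shift `J (n + j)` in the renormalized kernel. -/
theorem lev_up {n : ℕ} {x y : V} (h : T.up^[n] x ≠ T.up^[n] y) :
    T.lev x y = n + T.lev (T.up^[n] x) (T.up^[n] y) := by
  have hn : n ≤ T.lev x y := by
    by_contra hlt
    exact h (T.lev_le_iff.1 (not_le.1 hlt).le)
  apply le_antisymm
  · rw [lev_le_iff, ← T.up_add, ← T.up_add]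
    exact T.lev_le_iff.1 le_rfl
  · obtain ⟨k, hk⟩ := Nat.exists_eq_add_of_le hn
    rw [hk, Nat.add_le_add_iff_left, lev_le_iff, T.up_add, T.up_add, ← hk]
    exact T.lev_le_iff.1 le_rfl

/-- The level of a pair in the sphere of radius `j + 1` around the ball of radius `j`. -/
theorem lev_eq_succ {j : ℕ} {u y y' : V} (hy : y ∈ T.ball j (T.up^[j] u))
    (hy' : y' ∈ T.ball (j + 1) (T.up^[j + 1] u) \ T.ball j (T.up^[j] u)) :
    T.lev y y' = j + 1 := by
  rw [Finset.mem_sdiff, mem_ball, mem_ball] at hy'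
  rw [mem_ball] at hy
  apply le_antisymm
  · rw [lev_le_iff, ← T.up_add 1 j y, hy, hy'.1, T.up_add]
  · rw [Nat.succ_le_iff, ← not_le, lev_le_iff, hy]
    exact fun h => hy'.2 h.symm

end HTree

/-! ### Configurations and connections -/

section Conn

variable {V : Type}

/-- One step of an open path inside `B`. The diagonal pairs `s(x, x)` carry the states of sites. -/
def stepIn (c : Sym2 V → Bool) (B : Finset V) (x y : V) : Prop :=
  x ∈ B ∧ y ∈ B ∧ c s(x, x) = true ∧ c s(y, y) = true ∧ c s(x, y) = true

/-- The points `x` and `y` are joined by an open path inside `B`. -/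
def Conn (c : Sym2 V → Bool) (B : Finset V) : V → V → Prop := Relation.TransGen (stepIn c B)

variable {c : Sym2 V → Bool} {B B' : Finset V} {x y z : V}

theorem stepIn.symm (h : stepIn c B x y) : stepIn c B y x := by
  obtain ⟨h1, h2, h3, h4, h5⟩ := h
  exact ⟨h2, h1, h4, h3, by rwa [Sym2.eq_swap]⟩

theorem Conn.symm (h : Conn c B x y) : Conn c B y x := by
  induction h with
  | single h => exact .single h.symm
  | tail _ h ih => exact .head h.symm ih

theorem Conn.trans (h : Conn c B x y) (h' : Conn c B y z) : Conn c B x z :=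
  Relation.TransGen.trans h h'

theorem Conn.mono (hB : B ⊆ B') (h : Conn c B x y) : Conn c B' x y := by
  have key : ∀ {a b : V}, stepIn c B a b → stepIn c B' a b :=
    fun ⟨h1, h2, h3⟩ => ⟨hB h1, hB h2, h3⟩
  induction h with
  | single h => exact .single (key h)
  | tail _ h ih => exact ih.tail (key h)

theorem Conn.right (h : Conn c B x y) : y ∈ B ∧ c s(y, y) = true := by
  cases h with
  | single h => exact ⟨h.2.1, h.2.2.2.1⟩
  | tail _ h => exact ⟨h.2.1, h.2.2.2.1⟩

theorem Conn.left (h : Conn c B x y) : x ∈ B ∧ c s(x, x) = true := h.symm.right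

theorem Conn.refl (hx : x ∈ B) (h : c s(x, x) = true) : Conn c B x x := .single ⟨hx, hx, h, h, h⟩

theorem conn_congr {c c' : Sym2 V → Bool} (h : ∀ e ∈ B.sym2, c e = c' e) :
    Conn c B = Conn c' B := by
  have : stepIn c B = stepIn c' B := by
    ext x y
    unfold stepIn
    refine and_congr_right fun hx => and_congr_right fun hy => ?_
    rw [h s(x, x) (by simp [hx]), h s(y, y) (by simp [hy]), h s(x, y) (by simp [hx, hy])]
  unfold Conn
  rw [this]

/-- The cluster of `x` inside `B`; it is empty if `x` is closed. -/
def clus (c : Sym2 V → Bool) (B : Finset V) (x : V) : Finset V := B.filter (Conn c B x)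

theorem mem_clus : y ∈ clus c B x ↔ Conn c B x y := by
  simp only [clus, Finset.mem_filter, and_iff_right_iff_imp]
  exact fun h => h.right.1

theorem clus_subset : clus c B x ⊆ B := Finset.filter_subset _ _

end Conn

/-! ### Independence of events depending on disjoint sets of coordinates -/

section Indep

variable {ι Ω : Type} [MeasurableSpace Ω] {μ : Measure Ω} {X : ι → Ω → Bool}

/-- The configuration of a family of random bits. -/
def conf (X : ι → Ω → Bool) (ω : Ω) : ι → Bool := fun e => X e ω

theorem measurableSet_conf (hm : ∀ e, Measurable (X e)) {P : (ι → Bool) → Prop} {D : Finset ι}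
    (hP : DependsOn P D) : MeasurableSet {ω | P (conf X ω)} := by
  obtain ⟨g, rfl⟩ := dependsOn_iff_exists_comp.1 hP
  have h1 : Measurable (fun ω => (fun e : D => X e ω)) := measurable_pi_lambda _ fun e => hm e
  exact h1 (Set.toFinite {r | g r}).measurableSet

/-- Events determined by finitely many bits factor through finite spaces, so independence reduces to
that of two disjoint finite subfamilies. -/
theorem indep_conf [IsProbabilityMeasure μ] (hm : ∀ e, Measurable (X e)) (hi : iIndepFun X μ)
    {P Q : (ι → Bool) → Prop} {D E : Finset ι} (hP : DependsOn P D) (hQ : DependsOn Q E)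
    (hDE : Disjoint D E) :
    μ.real {ω | P (conf X ω) ∧ Q (conf X ω)} =
      μ.real {ω | P (conf X ω)} * μ.real {ω | Q (conf X ω)} := by
  obtain ⟨g, rfl⟩ := dependsOn_iff_exists_comp.1 hP
  obtain ⟨h, rfl⟩ := dependsOn_iff_exists_comp.1 hQ
  have := (hi.indepFun_finset D E hDE hm).measure_inter_preimage_eq_mul {r | g r} {r | h r}
    (Set.toFinite _).measurableSet (Set.toFinite _).measurableSet
  have h2 := congrArg ENNReal.toReal this
  rw [ENNReal.toReal_mul] at h2
  exact h2

theorem indep_conf_forall [IsProbabilityMeasure μ] (hm : ∀ e, Measurable (X e))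
    (hi : iIndepFun X μ) {κ : Type} {P : κ → (ι → Bool) → Prop} {D : κ → Finset ι}
    (hP : ∀ k, DependsOn (P k) (D k)) (t : Finset κ)
    (hD : ∀ k ∈ t, ∀ l ∈ t, k ≠ l → Disjoint (D k) (D l)) :
    μ.real {ω | ∀ k ∈ t, P k (conf X ω)} = ∏ k ∈ t, μ.real {ω | P k (conf X ω)} := by
  induction t using Finset.induction_on with
  | empty => simp
  | insert k t hk ih =>
    rw [Finset.prod_insert hk, ← ih fun a ha b hb =>
      hD a (Finset.mem_insert_of_mem ha) b (Finset.mem_insert_of_mem hb)]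
    have hQ : DependsOn (fun c : ι → Bool => ∀ l ∈ t, P l c) (t.biUnion D) := by
      intro c c' h
      refine propext (forall₂_congr fun l hl => ?_)
      rw [hP l fun i hi => h i (Finset.mem_coe.2 (Finset.mem_biUnion.2 ⟨l, hl, hi⟩))]
    rw [← indep_conf hm hi (hP k) hQ]
    · simp only [Finset.forall_mem_insert]
    · rw [Finset.disjoint_biUnion_right]
      exact fun l hl => hD k (Finset.mem_insert_self _ _) l (Finset.mem_insert_of_mem hl)
        (fun h => hk (h ▸ hl))

theorem dependsOn_bits {F : Finset ι} (b : ι → Bool) :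
    DependsOn (fun c : ι → Bool => ∀ e ∈ F, c e = b e) F := by
  intro c c' h
  exact propext (forall₂_congr fun e he => by rw [h e he])

theorem real_bits [IsProbabilityMeasure μ] (hm : ∀ e, Measurable (X e)) (hi : iIndepFun X μ)
    (F : Finset ι) :
    μ.real {ω | ∀ e ∈ F, X e ω = false} = ∏ e ∈ F, μ.real {ω | X e ω = false} := by
  refine indep_conf_forall (P := fun e c => c e = false) (D := fun e => {e}) hm hi ?_ F ?_
  · intro e c c' h
    have := h e (by simp)
    simp only [this]
  · intro k _ l _ h
    simpa using h

/-- Random bits are independent as soon as their zero events are. -/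
theorem iIndepFun_bits [IsProbabilityMeasure μ] (hm : ∀ e, Measurable (X e))
    (h : ∀ F : Finset ι,
      μ.real {ω | ∀ e ∈ F, X e ω = false} = ∏ e ∈ F, μ.real {ω | X e ω = false}) :
    iIndepFun X μ := by
  have hs : ∀ e, MeasurableSet {ω | X e ω = false} := fun e => hm e (measurableSet_singleton false)
  have h1 : iIndepSet (fun e => {ω | X e ω = false}) μ := by
    rw [iIndepSet_iff_meas_biInter hs]
    intro F
    have := h F
    simp only [measureReal_def, ← ENNReal.toReal_prod] at this
    rw [ENNReal.toReal_eq_toReal_iff' (measure_ne_top _ _)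
      (ENNReal.prod_ne_top fun _ _ => measure_ne_top _ _)] at this
    rw [← this]
    congr 1
    ext ω
    simp
  -- Independence of the zero events gives independence of their real indicators, and a bit is read
  -- off from the indicator by testing `r ≠ 1`.
  have hg : Measurable (fun r : ℝ => decide (r ≠ 1)) := by
    refine measurable_to_bool ?_
    have : (fun r : ℝ => decide (r ≠ 1)) ⁻¹' {true} = {1}ᶜ := by ext; simp
    rw [this]
    exact (measurableSet_singleton _).compl
  have h2 := (h1.iIndepFun_indicator (β := ℝ) (m := inferInstance)).comp
    (fun _ r => decide (r ≠ 1)) (fun _ => hg)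
  convert h2 using 1
  ext e ω
  by_cases he : X e ω = false <;> simp [Set.indicator, he]

end Indep

/-! ### Hierarchical site-bond percolation -/

/-- `X` is a family of independent site and bond states on `Sym2 V`; sites are closed with
probability at most `p`, bonds `s(x, y)` are closed with probability `exp (-J (lev x y))`. -/
structure Perc {V Ω : Type} {N : ℕ} [MeasurableSpace Ω] (T : HTree V N) (μ : Measure Ω)
    (X : Sym2 V → Ω → Bool) (p : ℝ) (J : ℕ → ℝ) : Prop where
  meas : ∀ e, Measurable (X e)
  indep : iIndepFun X μ
  site : ∀ x, μ.real {ω | X s(x, x) ω = false} ≤ p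
  bond : ∀ x y, x ≠ y → μ.real {ω | X s(x, y) ω = false} = Real.exp (-J (T.lev x y))

/-! ### Cores and the renormalized configuration -/

section Ren

variable {V Ω : Type} {N : ℕ} [MeasurableSpace Ω] (T : HTree V N) {μ : Measure Ω}
    {X : Sym2 V → Ω → Bool} {p : ℝ} {J : ℕ → ℝ}

/-- `S` is a set of `M` points of the `n`-ball `y`, pairwise related by `R`. -/
def IsCore (n M : ℕ) (R : V → V → Prop) (y : V) (S : Finset V) : Prop :=
  S ⊆ T.ball n y ∧ S.card = M ∧ ∀ a ∈ S, ∀ b ∈ S, R a b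

/-- A choice of a core, containing `o` if possible; an arbitrary set of the right size if there is
none. -/
def coreOf (n M : ℕ) (o : V) (R : V → V → Prop) (y : V) : Finset V :=
  if h : ∃ S, IsCore T n M R y S ∧ o ∈ S then h.choose
  else if h : ∃ S, IsCore T n M R y S then h.choose
  else if h : ∃ S ⊆ T.ball n y, S.card = M then h.choose else ∅

/-- The core of the `n`-ball `y` in the configuration `c`. -/
def core (n M : ℕ) (o : V) (c : Sym2 V → Bool) (y : V) : Finset V :=
  coreOf T n M o (Conn c (T.ball n y)) y

/-- The `n`-ball `y` contains `M` connected points. -/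
def IsGood (n M : ℕ) (c : Sym2 V → Bool) (y : V) : Prop :=
  ∃ S, IsCore T n M (Conn c (T.ball n y)) y S

/-- All pairs between the sets attached to the endpoints of a pair. -/
def crossPairs (γ : V → Finset V) : Sym2 V → Finset (Sym2 V) :=
  Sym2.lift ⟨fun y y' => Finset.image₂ (fun a b => s(a, b)) (γ y) (γ y'), fun y y' => by
    ext f
    simp only [Finset.mem_image₂]
    constructor
    · rintro ⟨a, ha, b, hb, rfl⟩; exact ⟨b, hb, a, ha, Sym2.eq_swap⟩
    · rintro ⟨a, ha, b, hb, rfl⟩; exact ⟨b, hb, a, ha, Sym2.eq_swap⟩⟩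

theorem mem_crossPairs {γ : V → Finset V} {y y' : V} {f : Sym2 V} :
    f ∈ crossPairs γ s(y, y') ↔ ∃ a ∈ γ y, ∃ b ∈ γ y', s(a, b) = f := by
  simp [crossPairs, Finset.mem_image₂]

/-- The renormalized configuration: a site is open if the corresponding `n`-ball is good, a bond if
there is an open bond between the two cores. -/
def ren (n M : ℕ) (o : V) (c : Sym2 V → Bool) (e : Sym2 V) : Bool :=
  if e.IsDiag then decide (∃ y ∈ e, IsGood T n M c y)
  else decide (∃ f ∈ crossPairs (core T n M o c) e, c f = true)

variable {T} {n M : ℕ} {o : V} {c : Sym2 V → Bool}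

theorem ren_diag {y : V} : ren T n M o c s(y, y) = true ↔ IsGood T n M c y := by
  simp [ren]

theorem ren_bond {y y' : V} (h : y ≠ y') : ren T n M o c s(y, y') = true ↔
    ∃ a ∈ core T n M o c y, ∃ b ∈ core T n M o c y', c s(a, b) = true := by
  rw [ren, if_neg (by simpa using h)]
  simp only [decide_eq_true_eq, mem_crossPairs]
  constructor
  · rintro ⟨_, ⟨a, ha, b, hb, rfl⟩, h⟩; exact ⟨a, ha, b, hb, h⟩
  · rintro ⟨a, ha, b, hb, h⟩; exact ⟨_, ⟨a, ha, b, hb, rfl⟩, h⟩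

theorem core_isCore {y : V} (h : IsGood T n M c y) :
    IsCore T n M (Conn c (T.ball n y)) y (core T n M o c y) := by
  unfold core coreOf
  unfold IsGood at h
  split_ifs with h1
  · exact h1.choose_spec.1
  · exact h.choose_spec

theorem mem_core {y : V} (h : ∃ S, IsCore T n M (Conn c (T.ball n y)) y S ∧ o ∈ S) :
    o ∈ core T n M o c y := by
  unfold core coreOf
  rw [dif_pos h]
  exact h.choose_spec.2

/-- Because of the default value in `coreOf`, even a bad ball has a core of exactly `M` points. Two
cores are thus always joined by `M ^ 2` potential bonds, and the law of a coarse bond does not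
depend on which balls are good. -/
theorem core_subset_card (hM : M ≤ N ^ n) (y : V) :
    core T n M o c y ⊆ T.ball n y ∧ (core T n M o c y).card = M := by
  unfold core coreOf
  split_ifs with h1 h2 h3
  · exact ⟨h1.choose_spec.1.1, h1.choose_spec.1.2.1⟩
  · exact ⟨h2.choose_spec.1, h2.choose_spec.2.1⟩
  · exact h3.choose_spec
  · exact absurd (Finset.exists_subset_card_eq (by rwa [T.card_ball])) h3

theorem core_congr {c' : Sym2 V → Bool} {y : V} (h : ∀ e ∈ (T.ball n y).sym2, c e = c' e) :
    core T n M o c y = core T n M o c' y := by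
  unfold core
  rw [conn_congr h]

theorem isGood_congr {c' : Sym2 V → Bool} {y : V} (h : ∀ e ∈ (T.ball n y).sym2, c e = c' e) :
    IsGood T n M c y = IsGood T n M c' y := by
  unfold IsGood
  rw [conn_congr h]

theorem dependsOn_isGood (y : V) :
    DependsOn (fun c => IsGood T n M c y) ((T.ball n y).sym2 : Finset (Sym2 V)) :=
  fun _ _ h => isGood_congr h

/-- Open paths of the renormalized configuration lift to open paths. -/
theorem Conn.of_ren (hM : M ≤ N ^ n) {B : Finset V} {y y' : V}
    (h : Conn (ren T n M o c) B y y') {a b : V} (ha : a ∈ core T n M o c y)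
    (hb : b ∈ core T n M o c y') : Conn c (B.biUnion (T.ball n)) a b := by
  have key : ∀ {y y' : V}, stepIn (ren T n M o c) B y y' → ∀ a ∈ core T n M o c y,
      ∀ b ∈ core T n M o c y', Conn c (B.biUnion (T.ball n)) a b := by
    rintro y y' ⟨hy, hy', h1, h2, h3⟩ a ha b hb
    rw [ren_diag] at h1 h2
    have i1 := core_isCore (o := o) h1
    have i2 := core_isCore (o := o) h2
    have s1 : T.ball n y ⊆ B.biUnion (T.ball n) := Finset.subset_biUnion_of_mem _ hy
    have s2 : T.ball n y' ⊆ B.biUnion (T.ball n) := Finset.subset_biUnion_of_mem _ hy'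
    by_cases hyy : y = y'
    · subst hyy
      exact (i1.2.2 a ha b hb).mono s1
    · obtain ⟨a', ha', b', hb', h4⟩ := (ren_bond hyy).1 h3
      have j1 := i1.2.2 a ha a' ha'
      have j2 := i2.2.2 b' hb' b hb
      refine ((j1.mono s1).trans (.single ⟨?_, ?_, ?_, ?_, h4⟩)).trans (j2.mono s2)
      · exact s1 j1.right.1
      · exact s2 j2.left.1
      · exact j1.right.2
      · exact j2.left.2
  induction h generalizing b with
  | single h => exact key h a ha b hb
  | @tail y1 y2 h1 h2 ih =>
    have hg : IsGood T n M c y1 := ren_diag.1 h2.2.2.1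
    -- `M` is positive because `b` lies in a core, and all cores have `M` points.
    obtain ⟨d, hd⟩ : (core T n M o c y1).Nonempty := by
      have hM0 : M ≠ 0 := by
        rintro rfl
        have := (core_subset_card (T := T) (c := c) (o := o) hM y2).2
        rw [Finset.card_eq_zero] at this
        simp [this] at hb
      rw [← Finset.card_pos, (core_subset_card hM y1).2]
      omega
    exact (ih hd).trans (key h2 d hd b hb)

/-- A cross bond remembers its coarse pair. Hence distinct coarse pairs use disjoint sets of bonds,
and an off-diagonal one uses no pair inside a ball, since such a pair has a diagonal image. -/
theorem map_of_mem_crossPairs {γ : V → Finset V} (hγ : ∀ y, γ y ⊆ T.ball n y) {e f : Sym2 V}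
    (hf : f ∈ crossPairs γ e) : f.map T.up^[n] = e := by
  induction e using Sym2.ind with
  | _ y y' =>
    obtain ⟨a, ha, b, hb, rfl⟩ := mem_crossPairs.1 hf
    rw [Sym2.map_mk, T.mem_ball.1 (hγ _ ha), T.mem_ball.1 (hγ _ hb)]

theorem Perc.prod_crossPairs (hX : Perc T μ X p J) {γ : V → Finset V}
    (hγ : ∀ y, γ y ⊆ T.ball n y ∧ (γ y).card = M) {y y' : V} (h : y ≠ y') :
    ∏ f ∈ crossPairs γ s(y, y'), μ.real {ω | X f ω = false} =
      Real.exp (-((M : ℝ) ^ 2 * J (n + T.lev y y'))) := by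
  have h1 : ∀ a ∈ γ y, ∀ b ∈ γ y', μ.real {ω | X s(a, b) ω = false} =
      Real.exp (-J (n + T.lev y y')) := by
    intro a ha b hb
    have ha' := T.mem_ball.1 ((hγ y).1 ha)
    have hb' := T.mem_ball.1 ((hγ y').1 hb)
    have hne : T.up^[n] a ≠ T.up^[n] b := by rwa [ha', hb']
    rw [hX.bond a b (fun h => hne (by rw [h])), T.lev_up hne, ha', hb']
  have h2 : (crossPairs γ s(y, y')) = ((γ y) ×ˢ (γ y')).image (fun q => s(q.1, q.2)) := by
    ext f
    simp [mem_crossPairs, and_assoc]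
  have h3 : Set.InjOn (fun q : V × V => s(q.1, q.2)) ((γ y) ×ˢ (γ y') : Finset (V × V)) := by
    rintro ⟨a, b⟩ hab ⟨a', b'⟩ hab' heq
    simp only [Finset.coe_product, Set.mem_prod, Finset.mem_coe] at hab hab'
    simp only [Sym2.eq_iff, Prod.mk.injEq] at heq ⊢
    rcases heq with heq | ⟨rfl, rfl⟩
    · exact heq
    · exact absurd ((T.mem_ball.1 ((hγ y).1 hab.1)).symm.trans
        (T.mem_ball.1 ((hγ y').1 hab'.2))) h
  rw [h2, Finset.prod_image h3, Finset.prod_congr rfl (g := fun _ => Real.exp (-J (n + T.lev y y')))]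
  · rw [Finset.prod_const, Finset.card_product, (hγ y).2, (hγ y').2, ← Real.exp_nat_mul]
    congr 1; push_cast; ring
  · rintro ⟨a, b⟩ hab
    rw [Finset.mem_product] at hab
    exact h1 a hab.1 b hab.2

end Ren

/-! ### The law of the renormalized configuration -/

section Ren

variable {V Ω : Type} {N : ℕ} [MeasurableSpace Ω] {T : HTree V N} {μ : Measure Ω}
    {X : Sym2 V → Ω → Bool} {p : ℝ} {J : ℕ → ℝ} {n M : ℕ} {o : V}

theorem real_eq_sum_fiber {ρ : Type} [Fintype ρ] [MeasurableSpace ρ] [MeasurableSingletonClass ρ]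
    [IsProbabilityMeasure μ] {Y : Ω → ρ} (hY : Measurable Y) (A : Set Ω) :
    μ.real A = ∑ r, μ.real {ω | Y ω = r ∧ ω ∈ A} := by
  have h := sum_measureReal_preimage_singleton (μ := μ.restrict A) (Finset.univ : Finset ρ)
    (f := Y) (fun y _ => hY (measurableSet_singleton y))
  simp only [Finset.coe_univ, Set.preimage_univ] at h
  rw [measureReal_restrict_apply MeasurableSet.univ, Set.univ_inter] at h
  rw [← h]
  refine Finset.sum_congr rfl fun r _ => ?_
  rw [measureReal_restrict_apply (hY (measurableSet_singleton r))]
  rfl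

/-- All off-diagonal pairs of `t` closed in the renormalized configuration, together with an event
inside the balls. -/
theorem Perc.real_ren_bonds [IsProbabilityMeasure μ] (hX : Perc T μ X p J) (hM : M ≤ N ^ n)
    (t : Finset (Sym2 V)) (ht : ∀ e ∈ t, ¬ e.IsDiag) (Y : Finset V)
    (hY : ∀ e ∈ t, ∀ y ∈ e, y ∈ Y) {P : (Sym2 V → Bool) → Prop}
    (hP : DependsOn P (Y.biUnion fun y => (T.ball n y).sym2 : Finset (Sym2 V)))
    {w : Sym2 V → ℝ}
    (hw : ∀ y y', y ≠ y' → w s(y, y') = Real.exp (-((M : ℝ) ^ 2 * J (n + T.lev y y')))) :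
    μ.real {ω | P (conf X ω) ∧ ∀ e ∈ t, ren T n M o (conf X ω) e = false} =
      μ.real {ω | P (conf X ω)} * ∏ e ∈ t, w e := by
  -- Condition on all states inside the balls of `Y`. As `D` is finite this is a finite sum over the
  -- values `r` of `R`; on each fiber the cores are fixed sets and the bonds between them lie
  -- outside `D`. The value `false` of `ext r` off `D` plays no role.
  set D : Finset (Sym2 V) := Y.biUnion fun y => (T.ball n y).sym2 with hD
  let R : Ω → (D → Bool) := fun ω e => X e ω
  have hR : Measurable R := measurable_pi_lambda _ fun e => hX.meas e
  let ext : (D → Bool) → (Sym2 V → Bool) := fun r e => if h : e ∈ D then r ⟨e, h⟩ else false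
  have hext : ∀ ω, ∀ e ∈ D, conf X ω e = ext (R ω) e := by
    intro ω e he
    simp [ext, he, R, conf]
  have hPext : ∀ ω, P (conf X ω) = P (ext (R ω)) := fun ω => hP fun e he => hext ω e he
  have hcore : ∀ ω, ∀ y ∈ Y, core T n M o (conf X ω) y = core T n M o (ext (R ω)) y :=
    fun ω y hy => core_congr fun e he => hext ω e (Finset.mem_biUnion.2 ⟨y, hy, he⟩)
  have hcross : ∀ ω, ∀ e ∈ t, crossPairs (core T n M o (conf X ω)) e =
      crossPairs (core T n M o (ext (R ω))) e := by
    intro ω e he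
    have hYe := hY e he
    induction e using Sym2.ind with
    | _ y y' =>
      ext f
      rw [mem_crossPairs, mem_crossPairs, hcore ω y (hYe y (by simp)),
        hcore ω y' (hYe y' (by simp))]
  have hren : ∀ ω, ∀ e ∈ t, (ren T n M o (conf X ω) e = false ↔
      ∀ f ∈ crossPairs (core T n M o (ext (R ω))) e, conf X ω f = false) := by
    intro ω e he
    rw [ren, if_neg (ht e he), hcross ω e he]
    simp
  have hsub : ∀ c : Sym2 V → Bool, ∀ y, core T n M o c y ⊆ T.ball n y ∧
    (core T n M o c y).card = M := fun c y => core_subset_card hM y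
  have hmapD : ∀ f ∈ D, (f.map T.up^[n]).IsDiag := by
    intro f hf
    obtain ⟨y, _, hf⟩ := Finset.mem_biUnion.1 hf
    induction f using Sym2.ind with
    | _ a b =>
      rw [Finset.mk_mem_sym2_iff] at hf
      rw [Sym2.map_mk, Sym2.mk_isDiag_iff, T.mem_ball.1 hf.1, T.mem_ball.1 hf.2]
  rw [real_eq_sum_fiber hR, real_eq_sum_fiber hR {ω | P (conf X ω)}, Finset.sum_mul]
  refine Finset.sum_congr rfl fun r _ => ?_
  by_cases hr : P (ext r)
  swap
  · have h1 : {ω | R ω = r ∧ ω ∈ {ω | P (conf X ω)}} = ∅ := by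
      ext ω
      simp only [Set.mem_ofPred_eq, Set.mem_empty_iff_false, iff_false, not_and]
      rintro rfl
      rwa [hPext]
    have h2 : {ω | R ω = r ∧ ω ∈ {ω | P (conf X ω) ∧
        ∀ e ∈ t, ren T n M o (conf X ω) e = false}} = ∅ := by
      refine Set.eq_empty_of_subset_empty fun ω hω => ?_
      rw [← h1]
      exact ⟨hω.1, hω.2.1⟩
    rw [h1, h2]; simp
  set γ := core T n M o (ext r) with hγ
  set F : Finset (Sym2 V) := t.biUnion (crossPairs γ) with hF
  have h1 : {ω | R ω = r ∧ ω ∈ {ω | P (conf X ω)}} =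
      {ω | (fun c : Sym2 V → Bool => ∀ e ∈ D, c e = ext r e) (conf X ω)} := by
    ext ω
    simp only [Set.mem_ofPred_eq]
    constructor
    · rintro ⟨rfl, _⟩ e he
      exact hext ω e he
    · intro h
      have : R ω = r := by
        funext e
        have := h e e.2
        simpa [ext, R, conf] using this
      exact ⟨this, by rw [hPext, this]; exact hr⟩
  have h2 : {ω | R ω = r ∧ ω ∈ {ω | P (conf X ω) ∧
        ∀ e ∈ t, ren T n M o (conf X ω) e = false}} =
      {ω | (fun c : Sym2 V → Bool => ∀ e ∈ D, c e = ext r e) (conf X ω) ∧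
        (fun c : Sym2 V → Bool => ∀ f ∈ F, c f = (fun _ => false) f) (conf X ω)} := by
    have : {ω | R ω = r ∧ ω ∈ {ω | P (conf X ω) ∧
        ∀ e ∈ t, ren T n M o (conf X ω) e = false}} =
        {ω | R ω = r ∧ ω ∈ {ω | P (conf X ω)}} ∩
        {ω | (fun c : Sym2 V → Bool => ∀ f ∈ F, c f = (fun _ => false) f) (conf X ω)} := by
      ext ω
      simp only [Set.mem_ofPred_eq, Set.mem_inter_iff, and_assoc]
      refine and_congr_right fun hω => and_congr_right fun _ => ?_
      simp only [hF, Finset.mem_biUnion, forall_exists_index, and_imp]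
      rw [forall_comm]
      simp only [hγ]
      constructor
      · intro h e f he hf
        exact (hren ω e he).1 (h e he) f (by rwa [hω])
      · intro h e he
        exact (hren ω e he).2 fun f hf => h e f he (by rwa [hω] at hf)
    rw [this, h1]
    rfl
  have hdisj : Disjoint D F := by
    rw [Finset.disjoint_left]
    intro f hf hf'
    obtain ⟨e, he, hfe⟩ := Finset.mem_biUnion.1 hf'
    apply ht e he
    rw [← map_of_mem_crossPairs (fun y => (hsub _ y).1) hfe]
    exact hmapD f hf
  rw [h2, h1, indep_conf hX.meas hX.indep (dependsOn_bits _) (dependsOn_bits _) hdisj]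
  congr 1
  refine (real_bits hX.meas hX.indep F).trans ?_
  rw [hF, Finset.prod_biUnion]
  · refine Finset.prod_congr rfl fun e he => ?_
    have hne := ht e he
    induction e using Sym2.ind with
    | _ y y' =>
      have hyy : y ≠ y' := by simpa using hne
      rw [hX.prod_crossPairs (hsub _) hyy, hw _ _ hyy]
  · intro e _ e' _ hee
    rw [Function.onFun, Finset.disjoint_left]
    intro f hf hf'
    exact hee ((map_of_mem_crossPairs (fun y => (hsub _ y).1) hf).symm.trans
      (map_of_mem_crossPairs (fun y => (hsub _ y).1) hf'))

theorem sym2_disjoint {B B' : Finset V} (h : Disjoint B B') : Disjoint B.sym2 B'.sym2 := by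
  rw [Finset.disjoint_left]
  intro e
  induction e using Sym2.ind with
  | _ a b =>
    rw [Finset.mk_mem_sym2_iff, Finset.mk_mem_sym2_iff]
    exact fun h1 h2 => Finset.disjoint_left.1 h h1.1 h2.1

/-- Renormalization turns hierarchical site-bond percolation into hierarchical site-bond
percolation. -/
theorem Perc.renormalize [IsProbabilityMeasure μ] (hX : Perc T μ X p J) (hM : M ≤ N ^ n) {p' : ℝ}
    (hp : ∀ y, μ.real {ω | ¬ IsGood T n M (conf X ω) y} ≤ p') :
    Perc T μ (fun e ω => ren T n M o (conf X ω) e) p' (fun j => (M : ℝ) ^ 2 * J (n + j)) := by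
  let w : Sym2 V → ℝ := Sym2.lift ⟨fun y y' => Real.exp (-((M : ℝ) ^ 2 * J (n + T.lev y y'))),
    fun y y' => by simp only [T.lev_comm y y']⟩
  have hw : ∀ y y', y ≠ y' → w s(y, y') = Real.exp (-((M : ℝ) ^ 2 * J (n + T.lev y y'))) :=
    fun _ _ _ => rfl
  have htrue : ∀ Y : Finset V, DependsOn (fun _ : Sym2 V → Bool => True)
      (Y.biUnion fun y => (T.ball n y).sym2 : Finset (Sym2 V)) := fun _ _ _ _ => rfl
  have hbond : ∀ e : Sym2 V, ¬ e.IsDiag →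
      μ.real {ω | ren T n M o (conf X ω) e = false} = w e := by
    intro e he
    -- The law of one coarse bond: `P` is trivial, and `Y` consists of the two endpoints of `e`,
    -- listed through `Fin 2`.
    have := hX.real_ren_bonds (o := o) hM {e} (by simpa using he)
      (Finset.univ.image (fun b : Fin 2 => if b = 0 then (Quot.out e).1 else (Quot.out e).2)) (by
        simp only [Finset.mem_singleton, forall_eq]
        have h1 : e = s((Quot.out e).1, (Quot.out e).2) := (Quot.out_eq e).symm
        intro y hy
        rw [h1, Sym2.mem_iff] at hy
        rw [Finset.mem_image]
        rcases hy with rfl | rfl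
        · exact ⟨0, Finset.mem_univ _, by simp⟩
        · exact ⟨1, Finset.mem_univ _, by simp⟩) (htrue _) hw
    simpa using this
  have hdiag : ∀ e : Sym2 V, e.IsDiag → ∃ y, e = s(y, y) := by
    intro e he
    induction e using Sym2.ind with
    | _ a b =>
      rw [Sym2.mk_isDiag_iff] at he
      exact ⟨a, by rw [he]⟩
  have hgm : ∀ y, MeasurableSet {ω | IsGood T n M (conf X ω) y} := fun y =>
    measurableSet_conf hX.meas (dependsOn_isGood y)
  have hmeas : ∀ e, Measurable fun ω => ren T n M o (conf X ω) e := by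
    intro e
    refine measurable_to_bool ?_
    change MeasurableSet {ω | ren T n M o (conf X ω) e = true}
    by_cases he : e.IsDiag
    · obtain ⟨y, rfl⟩ := hdiag e he
      simp only [ren_diag]
      exact hgm y
    · induction e using Sym2.ind with
      | _ y y' =>
        have hy : y ≠ y' := by simpa using he
        refine measurableSet_conf (P := fun c => ren T n M o c s(y, y') = true)
          (D := (T.ball n y ∪ T.ball n y').sym2) hX.meas ?_
        intro c c' h
        have h1 : core T n M o c y = core T n M o c' y := core_congr fun e he =>
          h e (Finset.sym2_mono Finset.subset_union_left he)
        have h2 : core T n M o c y' = core T n M o c' y' := core_congr fun e he =>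
          h e (Finset.sym2_mono Finset.subset_union_right he)
        simp only [ren_bond hy, h1, h2]
        refine propext ⟨?_, ?_⟩
        · rintro ⟨a, ha, b, hb, hab⟩
          refine ⟨a, ha, b, hb, ?_⟩
          rw [← h s(a, b)]
          · exact hab
          · rw [Finset.mem_coe, Finset.mk_mem_sym2_iff]
            exact ⟨Finset.mem_union_left _ ((core_subset_card hM y).1 ha),
              Finset.mem_union_right _ ((core_subset_card hM y').1 hb)⟩
        · rintro ⟨a, ha, b, hb, hab⟩
          refine ⟨a, ha, b, hb, ?_⟩
          rw [h s(a, b)]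
          · exact hab
          · rw [Finset.mem_coe, Finset.mk_mem_sym2_iff]
            exact ⟨Finset.mem_union_left _ ((core_subset_card hM y).1 ha),
              Finset.mem_union_right _ ((core_subset_card hM y').1 hb)⟩
  have hsite : ∀ y ω, (ren T n M o (conf X ω) s(y, y) = false ↔ ¬ IsGood T n M (conf X ω) y) := by
    intro y ω
    rw [← ren_diag (o := o)]
    simp
  refine ⟨hmeas, ?_, ?_, ?_⟩
  -- The diagonal pairs of `t` only involve the insides of balls, so they serve as the event `P` of
  -- `real_ren_bonds`, which splits off the coarse bonds. Goodness of distinct balls is then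
  -- independent because the balls are disjoint.
  · refine iIndepFun_bits hmeas fun t => ?_
    have hsplit := Finset.prod_filter_mul_prod_filter_not t (fun e => e.IsDiag)
      (fun e => μ.real {ω | ren T n M o (conf X ω) e = false})
    rw [← hsplit]
    set t1 := t.filter (fun e => e.IsDiag) with ht1
    set t2 := t.filter (fun e => ¬ e.IsDiag) with ht2
    set P : (Sym2 V → Bool) → Prop := fun c => ∀ e ∈ t1, ren T n M o c e = false with hPdef
    obtain ⟨Y, hYt⟩ : ∃ Y : Finset V, ∀ e ∈ t, ∀ y ∈ e, y ∈ Y :=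
      ⟨t.biUnion fun e => e.toFinset, fun e he y hy =>
        Finset.mem_biUnion.2 ⟨e, he, Sym2.mem_toFinset.2 hy⟩⟩
    have hPe : ∀ e : Sym2 V, e.IsDiag → DependsOn (fun c => ren T n M o c e = false)
        (e.toFinset.biUnion fun y => (T.ball n y).sym2 : Finset (Sym2 V)) := by
      intro e he
      obtain ⟨y, rfl⟩ := hdiag e he
      intro c c' h
      have h3 := isGood_congr (T := T) (M := M) (n := n) (y := y) (c := c) (c' := c') fun e he =>
        h e (Finset.mem_coe.2 (Finset.mem_biUnion.2 ⟨y, by simp, he⟩))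
      have h4 : ∀ c, (ren T n M o c s(y, y) = false) = ¬ IsGood T n M c y := by
        intro c
        rw [← ren_diag (o := o)]
        simp
      simp only [h4, h3]
    have hP : DependsOn P (Y.biUnion fun y => (T.ball n y).sym2 : Finset (Sym2 V)) := by
      intro c c' h
      refine propext (forall₂_congr fun e he => ?_)
      rw [ht1, Finset.mem_filter] at he
      have := hPe e he.2 (x := c) (y := c') fun f hf => h f (by
        simp only [Finset.mem_coe, Finset.mem_biUnion] at hf ⊢
        obtain ⟨y, hy, hf⟩ := hf
        exact ⟨y, hYt e he.1 y (Sym2.mem_toFinset.1 hy), hf⟩)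
      simpa using this
    have hset : {ω | ∀ e ∈ t, ren T n M o (conf X ω) e = false} =
        {ω | P (conf X ω) ∧ ∀ e ∈ t2, ren T n M o (conf X ω) e = false} := by
      ext ω
      simp only [Set.mem_ofPred_eq, hPdef, ht1, ht2, Finset.mem_filter]
      constructor
      · exact fun h => ⟨fun e he => h e he.1, fun e he => h e he.1⟩
      · rintro ⟨h1, h2⟩ e he
        by_cases hd : e.IsDiag
        · exact h1 e ⟨he, hd⟩
        · exact h2 e ⟨he, hd⟩
    rw [hset, hX.real_ren_bonds hM t2 (fun e he => (Finset.mem_filter.1 he).2) Y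
      (fun e he => hYt e (Finset.mem_filter.1 he).1) hP hw]
    congr 1
    · have h := indep_conf_forall (κ := {e : Sym2 V // e.IsDiag})
        (P := fun e c => ren T n M o c e.1 = false)
        (D := fun e => (e.1.toFinset.biUnion fun y => (T.ball n y).sym2)) hX.meas hX.indep
        (fun e => hPe e.1 e.2) (t1.subtype _) ?_
      · rw [Finset.prod_subtype_of_mem
          (fun e => μ.real {ω | ren T n M o (conf X ω) e = false})
          (fun e he => (Finset.mem_filter.1 he).2)] at h
        rw [← h]
        congr 1
        ext ω
        simp only [Set.mem_ofPred_eq, hPdef, Subtype.forall, Finset.mem_subtype]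
        exact ⟨fun h e _ he => h e he, fun h e he => h e (Finset.mem_filter.1 he).2 he⟩
      · rintro ⟨e, he⟩ _ ⟨e', he'⟩ _ hne
        obtain ⟨y, rfl⟩ := hdiag e he
        obtain ⟨y', rfl⟩ := hdiag e' he'
        have hy : y ≠ y' := fun h => hne (by subst h; rfl)
        rw [Finset.disjoint_biUnion_left]
        intro z hz
        rw [Finset.disjoint_biUnion_right]
        intro z' hz'
        simp at hz hz'
        subst hz hz'
        exact sym2_disjoint (T.ball_disjoint hy)
    · exact Finset.prod_congr rfl fun e he => (hbond e (Finset.mem_filter.1 he).2).symm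
  · intro y
    simp only [hsite]
    exact hp y
  · intro y y' h
    rw [hbond _ (by simpa using h)]
    rfl

end Ren

/-! ### Closed weight and isoperimetry -/

section Weight

variable {V Ω : Type} {N : ℕ} [MeasurableSpace Ω] (T : HTree V N) {μ : Measure Ω}
    {X : Sym2 V → Ω → Bool} {p : ℝ} {J : ℕ → ℝ}

namespace HTree

/-- The `j`-ball around `u`. -/
def cball (j : ℕ) (u : V) : Finset V := T.ball j (T.up^[j] u)

/-- The points at distance exactly `j + 1` from the `j`-ball around `u`. -/
def shell (j : ℕ) (u : V) : Finset V := T.cball (j + 1) u \ T.cball j u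

theorem card_cball (j : ℕ) (u : V) : (T.cball j u).card = N ^ j := T.card_ball _ _

theorem cball_mono {i j : ℕ} (h : i ≤ j) (u : V) : T.cball i u ⊆ T.cball j u := T.ball_mono h u

theorem card_shell (j : ℕ) (u : V) : (T.shell j u).card = N ^ (j + 1) - N ^ j := by
  rw [shell, Finset.card_sdiff_of_subset (T.cball_mono j.le_succ u), card_cball, card_cball]

theorem self_mem_cball (j : ℕ) (u : V) : u ∈ T.cball j u := T.mem_ball_self j u

end HTree

/-- The closed bonds from the `j`-ball around `u` to the surrounding shell. -/
def closedPairs (c : Sym2 V → Bool) (u : V) (j : ℕ) : Finset (V × V) :=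
  (T.cball j u ×ˢ T.shell j u).filter fun q => c s(q.1, q.2) = false

/-- The normalized weight of the closed bonds from the `j`-ball around `u` to its shell. -/
def closedWeight (c : Sym2 V → Bool) (u : V) (j : ℕ) : ℝ :=
  (closedPairs T c u j).card * ((N : ℝ) / (N : ℝ) ^ (2 * (j + 1)))

theorem mem_closedPairs {c : Sym2 V → Bool} {u : V} {j : ℕ} {q : V × V} :
    q ∈ closedPairs T c u j ↔
      q ∈ T.cball j u ×ˢ T.shell j u ∧ c s(q.1, q.2) = false := by
  rw [closedPairs, Finset.mem_filter]

theorem closedWeight_nonneg (c : Sym2 V → Bool) (u : V) (j : ℕ) : 0 ≤ closedWeight T c u j := by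
  unfold closedWeight; positivity

/-- The right side is the chance that exactly one of two independent events of probabilities `x`,
`z` occurs. If `x` and `z` lie on the same side of `1/2`, it dominates both of them or both
complements, hence the mixture; otherwise it is at least `1/2`. -/
theorem min_le_mix {x z t ρ : ℝ} (hx0 : 0 ≤ x) (hx1 : x ≤ 1) (hz0 : 0 ≤ z) (hz1 : z ≤ 1)
    (ht0 : 0 ≤ t) (ht1 : t ≤ 1) (hρ : ρ = (1 - t) * x + t * z) :
    min ρ (1 - ρ) ≤ x * (1 - z) + (1 - x) * z := by
  rcases le_total x (1 / 2) with hx | hx <;> rcases le_total z (1 / 2) with hz | hz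
  · apply (min_le_left _ _).trans
    have h1 : x ≤ x * (1 - z) + (1 - x) * z := by nlinarith
    have h2 : z ≤ x * (1 - z) + (1 - x) * z := by nlinarith
    rw [hρ]; nlinarith
  · have h1 : 1 / 2 ≤ x * (1 - z) + (1 - x) * z := by nlinarith
    rcases le_total ρ (1 / 2) with h | h
    · exact (min_le_left _ _).trans (by linarith)
    · exact (min_le_right _ _).trans (by linarith)
  · have h1 : 1 / 2 ≤ x * (1 - z) + (1 - x) * z := by nlinarith
    rcases le_total ρ (1 / 2) with h | h
    · exact (min_le_left _ _).trans (by linarith)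
    · exact (min_le_right _ _).trans (by linarith)
  · apply (min_le_right _ _).trans
    have h1 : 1 - x ≤ x * (1 - z) + (1 - x) * z := by nlinarith
    have h2 : 1 - z ≤ x * (1 - z) + (1 - x) * z := by nlinarith
    rw [hρ]; nlinarith

/-- The isoperimetric step: a set `S'` in the `(j+1)`-ball all of whose bonds to the complement,
except for those to a small set `A`, are closed. -/
theorem closedWeight_step (hN : 2 ≤ N) {c : Sym2 V → Bool} {u : V} {j : ℕ} {S S' A : Finset V}
    (hS : S ⊆ T.cball j u) (hS' : S' ⊆ T.cball (j + 1) u) (hSS : S ⊆ S')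
    (hcl : ∀ y ∈ S', ∀ y' ∈ T.cball (j + 1) u, y' ∉ S' → y' ∉ A → c s(y, y') = false) :
    (-((A.card : ℝ) / (N : ℝ) ^ j) ≤ (S'.card : ℝ) / (N : ℝ) ^ (j + 1) -
      (S.card : ℝ) / (N : ℝ) ^ j + closedWeight T c u j) ∧
    min ((S'.card : ℝ) / (N : ℝ) ^ (j + 1)) (1 - (S'.card : ℝ) / (N : ℝ) ^ (j + 1)) / 2 -
      (A.card : ℝ) / (N : ℝ) ^ j ≤ closedWeight T c u j := by
  set B := T.cball j u with hB
  set D := T.shell j u with hD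
  set α : ℝ := ((S' ∩ B).card : ℝ) with hα
  set β : ℝ := ((S' ∩ D).card : ℝ) with hβ
  set a : ℝ := (A.card : ℝ) with ha
  set m : ℝ := (N : ℝ) ^ j with hm
  have hN' : (2 : ℝ) ≤ N := by exact_mod_cast hN
  have hN0 : (0 : ℝ) < N := by linarith
  have hm0 : 0 < m := by positivity
  have hBD : B ∪ D = T.cball (j + 1) u := by
    rw [hD, HTree.shell, Finset.union_sdiff_of_subset (T.cball_mono j.le_succ u)]
  have hdisj : Disjoint B D := by rw [hD, HTree.shell]; exact Finset.disjoint_sdiff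
  have hcB : (B.card : ℝ) = m := by rw [hB, T.card_cball]; push_cast; rfl
  have hcD : (D.card : ℝ) = (N - 1) * m := by
    rw [hD, T.card_shell, Nat.cast_sub (Nat.pow_le_pow_right (by omega) j.le_succ)]
    rw [Nat.succ_eq_add_one, hm]; push_cast; ring
  have hcS' : (S'.card : ℝ) = α + β := by
    rw [hα, hβ, ← Nat.cast_add, ← Finset.card_union_of_disjoint, ← Finset.inter_union_distrib_left,
      hBD, Finset.inter_eq_left.2 hS']
    exact hdisj.mono Finset.inter_subset_right Finset.inter_subset_right
  have hcS : (S.card : ℝ) ≤ α := by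
    rw [hα]; exact_mod_cast Finset.card_le_card (Finset.subset_inter hSS hS)
  have hαm : α ≤ m := by
    rw [← hcB]; exact Nat.cast_le.2 (Finset.card_le_card Finset.inter_subset_right)
  have hβm : β ≤ (N - 1) * m := by
    rw [← hcD]; exact Nat.cast_le.2 (Finset.card_le_card Finset.inter_subset_right)
  have hα0 : 0 ≤ α := by positivity
  have hβ0 : 0 ≤ β := by positivity
  have ha0 : 0 ≤ a := by positivity
  have hc1 : (N - 1) * m - β - a ≤ ((D \ S') \ A).card := by
    have h1 : D.card ≤ (S' ∩ D).card + A.card + ((D \ S') \ A).card := by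
      calc D.card ≤ ((S' ∩ D) ∪ A ∪ ((D \ S') \ A)).card := Finset.card_le_card fun x hx => by
            simp only [Finset.mem_union, Finset.mem_inter, Finset.mem_sdiff]; tauto
        _ ≤ _ := (Finset.card_union_le _ _).trans (by gcongr; exact Finset.card_union_le _ _)
    have h2 : (D.card : ℝ) ≤ β + a + ((D \ S') \ A).card := by rw [hβ, ha]; exact_mod_cast h1
    linarith
  have hc2 : m - α - a ≤ ((B \ S') \ A).card := by
    have h1 : B.card ≤ (S' ∩ B).card + A.card + ((B \ S') \ A).card := by
      calc B.card ≤ ((S' ∩ B) ∪ A ∪ ((B \ S') \ A)).card := Finset.card_le_card fun x hx => by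
            simp only [Finset.mem_union, Finset.mem_inter, Finset.mem_sdiff]; tauto
        _ ≤ _ := (Finset.card_union_le _ _).trans (by gcongr; exact Finset.card_union_le _ _)
    have h2 : (B.card : ℝ) ≤ α + a + ((B \ S') \ A).card := by rw [hα, ha]; exact_mod_cast h1
    linarith
  have hcount : α * ((N - 1) * m - β - a) + (m - α - a) * β ≤ (closedPairs T c u j).card := by
    have h1 : ((S' ∩ B) ×ˢ ((D \ S') \ A)) ∪ (((B \ S') \ A) ×ˢ (S' ∩ D)) ⊆
        closedPairs T c u j := by
      rintro ⟨y, y'⟩ hq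
      simp only [Finset.mem_union, Finset.mem_product, Finset.mem_inter, Finset.mem_sdiff] at hq
      rw [mem_closedPairs, Finset.mem_product]
      have hsub1 : ∀ z ∈ B, z ∈ T.cball (j + 1) u := fun z hz => by
        rw [← hBD]; exact Finset.mem_union_left _ hz
      have hsub2 : ∀ z ∈ D, z ∈ T.cball (j + 1) u := fun z hz => by
        rw [← hBD]; exact Finset.mem_union_right _ hz
      rcases hq with ⟨⟨h1, h2⟩, ⟨h3, h4⟩, h5⟩ | ⟨⟨⟨h1, h2⟩, h3⟩, h4, h5⟩
      · exact ⟨⟨h2, h3⟩, hcl y h1 y' (hsub2 _ h3) h4 h5⟩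
      · exact ⟨⟨h1, h5⟩, by rw [Sym2.eq_swap]; exact hcl y' h4 y (hsub1 _ h1) h2 h3⟩
    have h2 := Finset.card_le_card h1
    rw [Finset.card_union_of_disjoint, Finset.card_product, Finset.card_product] at h2
    · have h3 : α * ((D \ S') \ A).card + ((B \ S') \ A).card * β ≤
          (closedPairs T c u j).card := by rw [hα, hβ]; exact_mod_cast h2
      have := mul_le_mul_of_nonneg_left hc1 hα0
      have := mul_le_mul_of_nonneg_right hc2 hβ0
      linarith
    · rw [Finset.disjoint_left]
      rintro ⟨y, y'⟩ h h'
      simp only [Finset.mem_product, Finset.mem_inter, Finset.mem_sdiff] at h h'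
      exact h'.1.1.2 h.1.1
  clear_value α β a m
  -- `x` and `z` are the densities of `S'` in the ball and in the shell, and `t` below is the share
  -- of the shell in the larger ball. So `S'` has density `(1 - t) x + t z`, and the closed weight
  -- is at least `t (x (1 - z) + (1 - x) z)` up to the error due to `A`.
  obtain ⟨x, hx⟩ : ∃ x : ℝ, x = α / m := ⟨_, rfl⟩
  obtain ⟨z, hz⟩ : ∃ z : ℝ, z = β / ((N - 1) * m) := ⟨_, rfl⟩
  have hN1 : (0 : ℝ) < N - 1 := by linarith
  have hxm : α = x * m := by rw [hx, div_mul_cancel₀ _ hm0.ne']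
  have hzm : β = z * ((N - 1) * m) := by rw [hz, div_mul_cancel₀ _ (mul_pos hN1 hm0).ne']
  have hx0 : 0 ≤ x := by rw [hx]; exact div_nonneg hα0 hm0.le
  have hx1 : x ≤ 1 := by rw [hx, div_le_one hm0]; exact hαm
  have hz0 : 0 ≤ z := by rw [hz]; exact div_nonneg hβ0 (mul_pos hN1 hm0).le
  have hz1 : z ≤ 1 := by rw [hz, div_le_one (mul_pos hN1 hm0)]; exact hβm
  have hw : closedWeight T c u j = (closedPairs T c u j).card / (N * m ^ 2) := by
    rw [closedWeight, hm]
    have : (N : ℝ) ^ (2 * (j + 1)) = N * (N * (N ^ j) ^ 2) := by ring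
    rw [this, div_mul_cancel_left₀ hN0.ne', div_eq_mul_inv]
  obtain ⟨t, ht⟩ : ∃ t : ℝ, t = (N - 1) / N := ⟨_, rfl⟩
  have ht0 : 1 / 2 ≤ t := by rw [ht, div_le_div_iff₀ (by norm_num) hN0]; linarith
  have ht1 : t ≤ 1 := by rw [ht, div_le_one hN0]; linarith
  have hρ : (S'.card : ℝ) / (N : ℝ) ^ (j + 1) = (1 - t) * x + t * z := by
    rw [hcS', hxm, hzm, ht, pow_succ, ← hm]; field_simp; ring
  have hwlow : t * (x * (1 - z) + (1 - x) * z) - a / m ≤ closedWeight T c u j := by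
    rw [hw]
    have h1 : (α * ((N - 1) * m - β) + (m - α) * β - a * (N * m)) / (N * m ^ 2) ≤
        (closedPairs T c u j).card / (N * m ^ 2) := by
      gcongr
      have : a * (α + β) ≤ a * (N * m) := mul_le_mul_of_nonneg_left (by linarith) ha0
      linarith
    refine le_trans (le_of_eq ?_) h1
    rw [hxm, hzm, ht]; field_simp
  have hSρ : (S.card : ℝ) / m ≤ x := by rw [hx]; gcongr
  constructor
  · rw [hρ]
    -- The density falls from `x` by `t (x - z)`, and `x (1 - z) + (1 - x) z` exceeds `x - z` by `2
    -- z (1 - x)`.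
    nlinarith [mul_nonneg (mul_nonneg (by linarith : (0 : ℝ) ≤ t) hz0) (sub_nonneg.2 hx1)]
  · rw [hρ]
    have h1 := min_le_mix hx0 hx1 hz0 hz1 (by linarith) ht1 (rfl : (1 - t) * x + t * z = _)
    have h2 : 0 ≤ x * (1 - z) + (1 - x) * z :=
      add_nonneg (mul_nonneg hx0 (by linarith)) (mul_nonneg (by linarith) hz0)
    have h3 := mul_le_mul_of_nonneg_right ht0 h2
    linarith

/-- Telescoping: density can only be lost by paying closed weight, up to `e` per level. -/
theorem sum_weight_ge {ρ w : ℕ → ℝ} {s W : ℕ} {e : ℝ} (hsW : s ≤ W)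
    (h : ∀ j, s ≤ j → j < W → -e ≤ ρ (j + 1) - ρ j + w j) :
    ρ s - ρ W - (W - s : ℕ) * e ≤ ∑ j ∈ Finset.Ico s W, w j := by
  induction W, hsW using Nat.le_induction with
  | base => simp
  | succ W hW ih =>
    rw [Finset.sum_Ico_succ_top hW]
    have h1 := ih fun j h1 h2 => h j h1 (by omega)
    have h2 := h W hW (by omega)
    have h3 : ((W + 1 - s : ℕ) : ℝ) = (W - s : ℕ) + 1 := by
      rw [Nat.sub_add_comm hW]; push_cast; ring
    rw [h3]; linarith

/-- If the density ever reaches `ε`, telescoping from `1 - 4 ε` charges `1 - 6 ε`. Otherwise it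
stays between `ε` and `1 - ε` after level `s`, and each level charges `ε / 2 - e`. The errors add up
to at most `ε / 4` over the window. -/
theorem sum_weight_ge_of_lost {ρ w : ℕ → ℝ} {s W K : ℕ} {e ε : ℝ} (hWK : W ≤ s + K)
    (hε0 : 0 < ε) (he0 : 0 ≤ e) (heK : K * e ≤ ε / 4) (hw : ∀ j, 0 ≤ w j)
    (h1 : ∀ j, s ≤ j → j < W → -e ≤ ρ (j + 1) - ρ j + w j)
    (h2 : ∀ j, s ≤ j → j < W → min (ρ (j + 1)) (1 - ρ (j + 1)) / 2 - e ≤ w j)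
    (hs : 1 - 4 * ε ≤ ρ s) (hW : ∀ j, s < j → j ≤ W → ρ j ≤ 1 - ε) :
    min (1 - 6 * ε) ((W - s : ℕ) * (ε / 2) - ε / 4) ≤ ∑ j ∈ Finset.Ico s W, w j := by
  have hKe : ∀ j, j ≤ W → ((j - s : ℕ) : ℝ) * e ≤ ε / 4 := fun j hj =>
    le_trans (by gcongr; omega) heK
  by_cases hsmall : ∃ j, s < j ∧ j ≤ W ∧ ρ j ≤ ε
  · obtain ⟨j, hj1, hj2, hj3⟩ := hsmall
    refine (min_le_left _ _).trans ?_
    have h3 := sum_weight_ge hj1.le fun i hi1 hi2 => h1 i hi1 (by omega)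
    have h4 : ∑ i ∈ Finset.Ico s j, w i ≤ ∑ i ∈ Finset.Ico s W, w i :=
      Finset.sum_le_sum_of_subset_of_nonneg (Finset.Ico_subset_Ico_right hj2) fun i _ _ => hw i
    have := hKe j hj2
    linarith
  · push Not at hsmall
    refine (min_le_right _ _).trans ?_
    have h3 : ∑ j ∈ Finset.Ico s W, (ε / 2 - e) ≤ ∑ j ∈ Finset.Ico s W, w j := by
      refine Finset.sum_le_sum fun j hj => ?_
      rw [Finset.mem_Ico] at hj
      have h4 := hsmall (j + 1) (by omega) (by omega)
      have h5 := hW (j + 1) (by omega) (by omega)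
      have h6 : ε ≤ min (ρ (j + 1)) (1 - ρ (j + 1)) := le_min h4.le (by linarith)
      linarith [h2 j hj.1 hj.2]
    rw [Finset.sum_const, Nat.card_Ico, nsmul_eq_mul] at h3
    have := hKe W le_rfl
    linarith

/-- The number of pairs counted by the closed weights between levels `s` and `W`. -/
def pairCount (N s W : ℕ) : ℕ := ∑ j ∈ Finset.Ico s W, N ^ j * (N ^ (j + 1) - N ^ j)

variable {T}

/-- Union bound over the possible sets of closed bonds: one of weight at least `h` is closed with
probability at most `exp (-(Λ h))`. Their number does not depend on `Λ`, so it becomes harmless when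
`Λ` is of order `log n`. -/
theorem Perc.real_closedWeight_ge [IsProbabilityMeasure μ] (hX : Perc T μ X p J) {Λ h : ℝ}
    {s W : ℕ} (hΛ : 0 ≤ Λ)
    (hJ : ∀ j, s ≤ j → j < W → Λ * ((N : ℝ) / (N : ℝ) ^ (2 * (j + 1))) ≤ J (j + 1)) (u : V) :
    μ.real {ω | h ≤ ∑ j ∈ Finset.Ico s W, closedWeight T (conf X ω) u j} ≤
      2 ^ pairCount N s W * Real.exp (-(Λ * h)) := by
  set P : Finset (Σ _ : ℕ, V × V) :=
    (Finset.Ico s W).sigma fun j => T.cball j u ×ˢ T.shell j u with hP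
  let g : (Σ _ : ℕ, V × V) → Sym2 V := fun q => s(q.2.1, q.2.2)
  let val : Finset (Σ _ : ℕ, V × V) → ℝ := fun F =>
    ∑ q ∈ F, (N : ℝ) / (N : ℝ) ^ (2 * (q.1 + 1))
  have hmemP : ∀ q ∈ P, (s ≤ q.1 ∧ q.1 < W) ∧ q.2.1 ∈ T.cball q.1 u ∧ q.2.2 ∈ T.shell q.1 u := by
    intro q hq
    rw [hP, Finset.mem_sigma, Finset.mem_Ico, Finset.mem_product] at hq
    exact hq
  have hlev : ∀ q ∈ P, T.lev q.2.1 q.2.2 = q.1 + 1 := fun q hq =>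
    T.lev_eq_succ (hmemP q hq).2.1 (hmemP q hq).2.2
  have hnot : ∀ q ∈ P, q.2.2 ∉ T.cball q.1 u := fun q hq => by
    have := (hmemP q hq).2.2
    rw [HTree.shell, Finset.mem_sdiff] at this
    exact this.2
  -- The level of a pair determines `j`, and the endpoint inside the `j`-ball determines the
  -- orientation.
  have hginj : Set.InjOn g P := by
    rintro ⟨j, y, y'⟩ hq ⟨j', z, z'⟩ hq' heq
    have h1 := hlev _ hq
    have h2 := hlev _ hq'
    have h3 : s(y, y') = s(z, z') := heq
    rw [Sym2.eq_iff] at h3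
    have hj : j = j' := by
      rcases h3 with ⟨rfl, rfl⟩ | ⟨rfl, rfl⟩
      · simp only at h1 h2; omega
      · rw [T.lev_comm] at h2; simp only at h1 h2; omega
    subst hj
    rcases h3 with ⟨rfl, rfl⟩ | ⟨rfl, rfl⟩
    · rfl
    · exact absurd (hmemP _ hq).2.1 (hnot _ hq')
  have hbound : ∀ F ∈ P.powerset.filter (fun F => h ≤ val F),
      μ.real {ω | ∀ q ∈ F, X (g q) ω = false} ≤ Real.exp (-(Λ * h)) := by
    intro F hF
    rw [Finset.mem_filter, Finset.mem_powerset] at hF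
    have h1 : {ω | ∀ q ∈ F, X (g q) ω = false} = {ω | ∀ f ∈ F.image g, X f ω = false} := by
      ext ω; simp only [Set.mem_ofPred_eq, Finset.forall_mem_image]
    rw [h1, real_bits hX.meas hX.indep, Finset.prod_image (hginj.mono (by exact_mod_cast hF.1))]
    have h2 : ∀ q ∈ F, μ.real {ω | X (g q) ω = false} = Real.exp (-J (q.1 + 1)) := by
      intro q hq
      have hqP := hF.1 hq
      rw [← hlev q hqP]
      refine hX.bond _ _ fun heq => hnot q hqP ?_
      rw [← heq]; exact (hmemP q hqP).2.1
    rw [Finset.prod_congr rfl h2, ← Real.exp_sum, Finset.sum_neg_distrib]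
    apply Real.exp_le_exp.2
    apply neg_le_neg
    calc Λ * h ≤ Λ * val F := mul_le_mul_of_nonneg_left hF.2 hΛ
      _ = ∑ q ∈ F, Λ * ((N : ℝ) / (N : ℝ) ^ (2 * (q.1 + 1))) := Finset.mul_sum _ _ _
      _ ≤ _ := Finset.sum_le_sum fun q hq =>
        hJ q.1 (hmemP q (hF.1 hq)).1.1 (hmemP q (hF.1 hq)).1.2
  have hsub : {ω | h ≤ ∑ j ∈ Finset.Ico s W, closedWeight T (conf X ω) u j} ⊆
      ⋃ F ∈ P.powerset.filter (fun F => h ≤ val F), {ω | ∀ q ∈ F, X (g q) ω = false} := by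
    intro ω hω
    simp only [Set.mem_iUnion]
    refine ⟨P.filter fun q => X (g q) ω = false, ?_, fun q hq => (Finset.mem_filter.1 hq).2⟩
    rw [Finset.mem_filter, Finset.mem_powerset]
    refine ⟨Finset.filter_subset _ _, le_of_le_of_eq hω ?_⟩
    have : P.filter (fun q => X (g q) ω = false) =
        (Finset.Ico s W).sigma fun j => closedPairs T (conf X ω) u j := by
      ext ⟨j, y, y'⟩
      simp only [hP, mem_closedPairs, conf, g, Finset.mem_filter, Finset.mem_sigma, and_assoc]
    simp only [val, this, Finset.sum_sigma, Finset.sum_const, closedWeight, nsmul_eq_mul]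
  have hcard : P.card = pairCount N s W := by
    rw [hP, Finset.card_sigma, pairCount]
    refine Finset.sum_congr rfl fun j _ => ?_
    rw [Finset.card_product, T.card_cball, T.card_shell]
  calc _ ≤ μ.real (⋃ F ∈ P.powerset.filter (fun F => h ≤ val F),
        {ω | ∀ q ∈ F, X (g q) ω = false}) := measureReal_mono hsub (measure_ne_top _ _)
    _ ≤ ∑ F ∈ P.powerset.filter (fun F => h ≤ val F), μ.real {ω | ∀ q ∈ F, X (g q) ω = false} :=
      measureReal_biUnion_finset_le _ _
    _ ≤ ∑ F ∈ P.powerset.filter (fun F => h ≤ val F), Real.exp (-(Λ * h)) :=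
      Finset.sum_le_sum hbound
    _ ≤ ∑ F ∈ P.powerset, Real.exp (-(Λ * h)) :=
      Finset.sum_le_sum_of_subset_of_nonneg (Finset.filter_subset _ _) fun _ _ _ =>
        (Real.exp_pos _).le
    _ = _ := by rw [Finset.sum_const, Finset.card_powerset, hcard, nsmul_eq_mul]; push_cast; rfl

/-- It is unlikely that more than `r` sites of a ball are closed. -/
theorem Perc.real_closedSites [IsProbabilityMeasure μ] (hX : Perc T μ X p J) (hp : 0 ≤ p)
    (B : Finset V) (r : ℕ) :
    μ.real {ω | r < (B.filter fun y => X s(y, y) ω = false).card} ≤ (B.card * p) ^ (r + 1) := by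
  have hsub : {ω | r < (B.filter fun y => X s(y, y) ω = false).card} ⊆
      ⋃ A ∈ B.powersetCard (r + 1), {ω | ∀ y ∈ A, X s(y, y) ω = false} := by
    intro ω hω
    obtain ⟨A, hA, hAc⟩ := Finset.exists_subset_card_eq (Nat.succ_le_of_lt hω)
    simp only [Set.mem_iUnion, Finset.mem_powersetCard]
    exact ⟨A, ⟨hA.trans (Finset.filter_subset _ _), hAc⟩,
      fun y hy => (Finset.mem_filter.1 (hA hy)).2⟩
  have hbound : ∀ A ∈ B.powersetCard (r + 1),
      μ.real {ω | ∀ y ∈ A, X s(y, y) ω = false} ≤ p ^ (r + 1) := by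
    intro A hA
    rw [Finset.mem_powersetCard] at hA
    have hinj : Set.InjOn (fun y : V => s(y, y)) A := by
      intro a _ b _ h
      simpa using h
    have h1 : {ω | ∀ y ∈ A, X s(y, y) ω = false} =
        {ω | ∀ f ∈ A.image (fun y => s(y, y)), X f ω = false} := by
      ext ω; simp
    rw [h1, real_bits hX.meas hX.indep, Finset.prod_image hinj, ← hA.2, ← Finset.prod_const]
    exact Finset.prod_le_prod (fun _ _ => measureReal_nonneg) fun y _ => hX.site y
  calc _ ≤ μ.real (⋃ A ∈ B.powersetCard (r + 1), {ω | ∀ y ∈ A, X s(y, y) ω = false}) :=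
        measureReal_mono hsub (measure_ne_top _ _)
    _ ≤ ∑ A ∈ B.powersetCard (r + 1), μ.real {ω | ∀ y ∈ A, X s(y, y) ω = false} :=
      measureReal_biUnion_finset_le _ _
    _ ≤ ∑ A ∈ B.powersetCard (r + 1), p ^ (r + 1) := Finset.sum_le_sum hbound
    _ = (B.card.choose (r + 1) : ℕ) * p ^ (r + 1) := by
      rw [Finset.sum_const, Finset.card_powersetCard, nsmul_eq_mul]
    _ ≤ (B.card : ℝ) ^ (r + 1) * p ^ (r + 1) := by
      gcongr
      exact_mod_cast Nat.choose_le_pow _ _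
    _ = _ := (mul_pow _ _ _).symm

end Weight

/-! ### Big clusters and their loss within a window of levels -/

section Window

variable {V Ω : Type} {N : ℕ} [MeasurableSpace Ω] (T : HTree V N) {μ : Measure Ω}
    {X : Sym2 V → Ω → Bool} {p : ℝ} {J : ℕ → ℝ}

/-- The cluster of `x` in its `i`-ball occupies at least a fraction `θ` of the ball. -/
def IsBig (θ : ℝ) (c : Sym2 V → Bool) (i : ℕ) (x : V) : Prop :=
  θ * (N : ℝ) ^ i ≤ (clus c (T.cball i x) x).card

theorem dependsOn_isBig (θ : ℝ) (i : ℕ) (x : V) :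
    DependsOn (fun c => IsBig T θ c i x) ((T.cball i x).sym2 : Finset (Sym2 V)) := by
  intro c c' h
  have : clus c (T.cball i x) x = clus c' (T.cball i x) x := by
    unfold clus
    rw [conn_congr h]
  simp only [IsBig, this]

theorem markov_count [IsProbabilityMeasure μ] (B : Finset V) {E : V → Set Ω}
    (hE : ∀ x, MeasurableSet (E x)) {γ t : ℝ} (hγ : ∀ x ∈ B, μ.real (E x) ≤ γ) (ht : 0 < t) :
    μ.real {ω | t ≤ (B.filter fun x => ω ∈ E x).card} ≤ B.card * γ / t := by
  have hf : ∀ ω, ((B.filter fun x => ω ∈ E x).card : ℝ) =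
      ∑ x ∈ B, (E x).indicator (fun _ => (1 : ℝ)) ω := by
    intro ω
    simp [Set.indicator]
  have hint : ∀ x ∈ B, Integrable ((E x).indicator (fun _ => (1 : ℝ))) μ := fun x _ =>
    (integrable_const _).indicator (hE x)
  have h := mul_meas_ge_le_integral_of_nonneg (μ := μ)
    (f := fun ω => ∑ x ∈ B, (E x).indicator (fun _ => (1 : ℝ)) ω)
    (Filter.Eventually.of_forall fun ω => Finset.sum_nonneg fun x _ =>
      Set.indicator_nonneg (fun _ _ => zero_le_one) ω) (integrable_finsetSum _ hint) t
  rw [integral_finsetSum _ hint] at h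
  simp only [hf]
  rw [le_div_iff₀ ht, mul_comm]
  refine h.trans ?_
  calc ∑ x ∈ B, ∫ ω, (E x).indicator (fun _ => (1 : ℝ)) ω ∂μ = ∑ x ∈ B, μ.real (E x) := by
        refine Finset.sum_congr rfl fun x _ => ?_
        rw [integral_indicator (hE x)]; simp
    _ ≤ ∑ x ∈ B, γ := Finset.sum_le_sum hγ
    _ = _ := by rw [Finset.sum_const, nsmul_eq_mul]

variable {T}

/-- Two disjoint clusters cannot both fill more than half of a ball. -/
theorem IsBig.conn {θ : ℝ} (hθ : 1 / 2 < θ) (hN : 0 < N) {c : Sym2 V → Bool} {i : ℕ} {y a b : V}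
    (ha : a ∈ T.ball i y) (hb : b ∈ T.ball i y) (hA : IsBig T θ c i a) (hB : IsBig T θ c i b) :
    Conn c (T.ball i y) a b := by
  have ha' : T.cball i a = T.ball i y := by rw [HTree.cball, T.mem_ball.1 ha]
  have hb' : T.cball i b = T.ball i y := by rw [HTree.cball, T.mem_ball.1 hb]
  rw [IsBig, ha'] at hA
  rw [IsBig, hb'] at hB
  by_contra hab
  have hd : Disjoint (clus c (T.ball i y) a) (clus c (T.ball i y) b) := by
    rw [Finset.disjoint_left]
    intro z hz hz'
    exact hab ((mem_clus.1 hz).trans (mem_clus.1 hz').symm)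
  have h1 := Finset.card_le_card (Finset.union_subset
    (clus_subset (c := c) (B := T.ball i y) (x := a))
    (clus_subset (c := c) (B := T.ball i y) (x := b)))
  rw [Finset.card_union_of_disjoint hd, T.card_ball] at h1
  have h2 : ((clus c (T.ball i y) a).card : ℝ) + (clus c (T.ball i y) b).card ≤ (N : ℝ) ^ i := by
    exact_mod_cast h1
  have h3 : (0 : ℝ) < (N : ℝ) ^ i := by positivity
  nlinarith

theorem isGood_of_count {θ : ℝ} (hθ : 1 / 2 < θ) (hN : 0 < N) {c : Sym2 V → Bool} {i M : ℕ}
    {y : V} (h : M ≤ ((T.ball i y).filter fun x => IsBig T θ c i x).card) : IsGood T i M c y := by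
  obtain ⟨S, hS, hSc⟩ := Finset.exists_subset_card_eq h
  refine ⟨S, hS.trans (Finset.filter_subset _ _), hSc, fun a ha b hb => ?_⟩
  have ha' := Finset.mem_filter.1 (hS ha)
  have hb' := Finset.mem_filter.1 (hS hb)
  exact IsBig.conn hθ hN ha'.1 hb'.1 ha'.2 hb'.2

/-- By Markov, fewer than `ε N ^ i` points of the ball miss a big cluster, up to probability `γ /
ε`; the others form cores. The bound on `M` is the one satisfied by the ceiling of `(1 - ε) N ^ i`.
-/
theorem Perc.real_not_isGood_le [IsProbabilityMeasure μ] (hX : Perc T μ X p J) (hN : 0 < N)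
    {θ ε γ : ℝ} (hθ : 1 / 2 < θ) (hε : 0 < ε) {i M : ℕ} (hM : (M : ℝ) < (1 - ε) * (N : ℝ) ^ i + 1)
    (hγ : ∀ x, μ.real {ω | ¬ IsBig T θ (conf X ω) i x} ≤ γ) (y : V) :
    μ.real {ω | ¬ IsGood T i M (conf X ω) y} ≤ γ / ε := by
  have hm : ∀ x, MeasurableSet {ω | ¬ IsBig T θ (conf X ω) i x} := fun x =>
    (measurableSet_conf hX.meas (dependsOn_isBig T θ i x)).compl
  have hN' : (0 : ℝ) < (N : ℝ) ^ i := by positivity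
  have h := markov_count (T.ball i y) hm (t := ε * (N : ℝ) ^ i) (fun x _ => hγ x) (by positivity)
  rw [T.card_ball] at h
  refine (measureReal_mono ?_ (measure_ne_top _ _)).trans (h.trans (le_of_eq ?_))
  · intro ω hω
    by_contra hlt
    apply hω
    apply isGood_of_count hθ hN
    have h1 := Finset.card_filter_add_card_filter_not (s := T.ball i y)
      (fun x => IsBig T θ (conf X ω) i x)
    rw [T.card_ball] at h1
    have h2 : (((T.ball i y).filter fun x => IsBig T θ (conf X ω) i x).card : ℝ) +
        ((T.ball i y).filter fun x => ¬ IsBig T θ (conf X ω) i x).card = (N : ℝ) ^ i := by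
      exact_mod_cast h1
    have h3 : (((T.ball i y).filter fun x => ¬ IsBig T θ (conf X ω) i x).card : ℝ) <
        ε * (N : ℝ) ^ i := by simpa only [Set.mem_ofPred_eq, not_le] using hlt
    have h4 : (M : ℝ) < ((T.ball i y).filter fun x => IsBig T θ (conf X ω) i x).card + 1 := by
      linarith
    exact Nat.lt_succ_iff.1 (by exact_mod_cast h4)
  · push_cast; field_simp

/-- A point of an open ball whose cluster is small sees a large weight of closed bonds. -/
theorem closedWeight_ge_of_open (hN : 2 ≤ N) {c : Sym2 V → Bool} {θ : ℝ} {i : ℕ} {x : V}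
    (ho : ∀ y ∈ T.cball i x, c s(y, y) = true) (hb : ¬ IsBig T θ c i x) :
    1 - θ ≤ ∑ j ∈ Finset.Ico 0 i, closedWeight T c x j := by
  -- The density of these clusters falls from `1` at level `0` to at most `θ` at level `i`. As all
  -- sites are open, the exceptional set is empty.
  let S : ℕ → Finset V := fun j => clus c (T.cball j x) x
  have h0 : (S 0).card = 1 := by
    rw [Finset.card_eq_one]
    refine ⟨x, Finset.Subset.antisymm ?_ ?_⟩
    · exact clus_subset
    · intro y hy
      rw [Finset.mem_singleton] at hy
      subst hy
      exact mem_clus.2 (.refl (T.self_mem_cball 0 y) (ho y (T.self_mem_cball i y)))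
  have hstep : ∀ j, 0 ≤ j → j < i → -(0 : ℝ) ≤ (fun j => ((S j).card : ℝ) / (N : ℝ) ^ j) (j + 1) -
      (fun j => ((S j).card : ℝ) / (N : ℝ) ^ j) j + closedWeight T c x j := by
    intro j _ hj
    have := (closedWeight_step T hN (c := c) (u := x) (j := j) (S := S j) (S' := S (j + 1))
      (A := ∅) clus_subset clus_subset ?_ ?_).1
    · simpa using this
    · intro y hy
      exact mem_clus.2 ((mem_clus.1 hy).mono (T.cball_mono j.le_succ x))
    · intro y hy y' hy' hn _
      by_contra hc
      rw [Bool.not_eq_false] at hc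
      have hy := mem_clus.1 hy
      exact hn (mem_clus.2 (hy.tail ⟨hy.right.1, hy', hy.right.2,
        ho _ (T.cball_mono hj x hy'), hc⟩))
  have h1 := sum_weight_ge (ρ := fun j => ((S j).card : ℝ) / (N : ℝ) ^ j) (Nat.zero_le i) hstep
  have h2 : ((S i).card : ℝ) / (N : ℝ) ^ i ≤ θ := by
    have hN' : (0 : ℝ) < (N : ℝ) ^ i := by positivity
    rw [div_le_iff₀ hN']
    exact (not_le.1 hb).le
  simp only [h0] at h1
  norm_num at h1
  simpa using (by linarith : 1 - θ ≤ _)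

/-- A point which has a big cluster at level `i + s` but not at the following levels sees a large
weight of closed bonds in the renormalized configuration. -/
theorem closedWeight_ge_of_lost (hN : 2 ≤ N) {c : Sym2 V → Bool} {o x : V} {ε : ℝ}
    {i s W K M r : ℕ} (hε0 : 0 < ε) (hε : ε ≤ 1 / 20) (hWK : W ≤ s + K) (hsW : s ≤ W)
    (hM : (1 - ε) * (N : ℝ) ^ i ≤ M) (hMN : M ≤ N ^ i) (hr : (K + 1) * (r / (N : ℝ) ^ s) ≤ ε / 4)
    (hA : ((T.cball W (T.up^[i] x)).filter fun y => ren T i M o c s(y, y) = false).card ≤ r)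
    (hs : IsBig T (1 - 2 * ε) c (i + s) x)
    (hW : ∀ j, s < j → j ≤ W → ¬ IsBig T (1 - 2 * ε) c (i + j) x) :
    min (1 - 6 * ε) ((W - s : ℕ) * (ε / 2) - ε / 4) ≤
      ∑ j ∈ Finset.Ico s W, closedWeight T (ren T i M o c) (T.up^[i] x) j := by
  set u := T.up^[i] x with hu
  set c' := ren T i M o c with hc'
  set A := (T.cball W u).filter fun y => c' s(y, y) = false with hAdef
  have hball : ∀ j, T.cball (i + j) x = (T.cball j u).biUnion (T.ball i) := by
    intro j
    rw [HTree.cball, HTree.cball, T.ball_add, hu, T.up_add]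
  have hsub : ∀ j, ∀ y ∈ T.cball j u, T.ball i y ⊆ T.cball (i + j) x := fun j y hy => by
    rw [hball]; exact Finset.subset_biUnion_of_mem _ hy
  have hgood : ∀ y, c' s(y, y) = true → IsCore T i M (Conn c (T.ball i y)) y (core T i M o c y) :=
    fun y hy => core_isCore (ren_diag.1 hy)
  -- The coarse trace of the cluster of `x`: the good `i`-balls whose core it reaches inside the `(i
  -- + j)`-ball. An open coarse bond from `S j` to another good ball there would extend the cluster,
  -- so only the bad balls `A` are exceptional.
  let S : ℕ → Finset V := fun j => (T.cball j u).filter fun y =>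
    c' s(y, y) = true ∧ ∃ z ∈ core T i M o c y, Conn c (T.cball (i + j) x) x z
  have hmemS : ∀ j y, y ∈ S j ↔ y ∈ T.cball j u ∧ c' s(y, y) = true ∧
      ∃ z ∈ core T i M o c y, Conn c (T.cball (i + j) x) x z := fun j y => Finset.mem_filter
  have hSall : ∀ j, ∀ y ∈ S j, ∀ z ∈ core T i M o c y, Conn c (T.cball (i + j) x) x z := by
    intro j y hy z hz
    obtain ⟨h1, h2, z', hz', h3⟩ := (hmemS j y).1 hy
    exact h3.trans (((hgood y h2).2.2 z' hz' z hz).mono (hsub j y h1))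
  have hcl : ∀ j, ∀ y ∈ S j, ∀ y' ∈ T.cball j u, y' ∉ S j → j ≤ W → y' ∉ A →
      c' s(y, y') = false := by
    intro j y hy y' hy' hn hjW hyA
    by_contra hc
    rw [Bool.not_eq_false] at hc
    have hg' : c' s(y', y') = true := by
      by_contra h
      rw [Bool.not_eq_true] at h
      exact hyA (Finset.mem_filter.2 ⟨T.cball_mono hjW u hy', h⟩)
    have hne : y ≠ y' := by rintro rfl; exact hn hy
    obtain ⟨a, ha, b, hb, hab⟩ := (ren_bond hne).1 hc
    have h1 := hSall j y hy a ha
    have h2 := (hgood y' hg').2.2 b hb b hb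
    exact hn ((hmemS j y').2 ⟨hy', hg', b, hb, h1.tail
      ⟨h1.right.1, hsub j y' hy' h2.left.1, h1.right.2, h2.left.2, hab⟩⟩)
  have hstep : ∀ j, s ≤ j → j < W → _ := fun j _ hj =>
    closedWeight_step T hN (c := c') (u := u) (j := j) (S := S j) (S' := S (j + 1))
      (A := A) (Finset.filter_subset _ _) (Finset.filter_subset _ _) (fun y hy => by
        obtain ⟨h1, h2, z, hz, h3⟩ := (hmemS j y).1 hy
        exact (hmemS _ _).2 ⟨T.cball_mono j.le_succ u h1, h2, z, hz,
          h3.mono (T.cball_mono (by omega) x)⟩)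
      (fun y hy y' hy' hn => hcl (j + 1) y hy y' hy' hn hj)
  have hN0 : (0 : ℝ) < N := by positivity
  have hN1 : (1 : ℝ) ≤ N := by exact_mod_cast (by omega : 1 ≤ N)
  have hAe : ∀ j, s ≤ j → (A.card : ℝ) / (N : ℝ) ^ j ≤ r / (N : ℝ) ^ s := by
    intro j hj
    have h1 : (A.card : ℝ) ≤ r := by exact_mod_cast hA
    gcongr
  have hcores : ∀ j, (S j).card * M ≤ (clus c (T.cball (i + j) x) x).card := by
    intro j
    have h1 : (S j).biUnion (core T i M o c) ⊆ clus c (T.cball (i + j) x) x := by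
      intro z hz
      obtain ⟨y, hy, hz⟩ := Finset.mem_biUnion.1 hz
      exact mem_clus.2 (hSall j y hy z hz)
    refine le_trans (le_of_eq ?_) (Finset.card_le_card h1)
    rw [Finset.card_biUnion, Finset.sum_congr rfl fun y _ => (core_subset_card hMN y).2,
      Finset.sum_const, smul_eq_mul]
    intro y _ y' _ hne
    exact (T.ball_disjoint hne).mono (core_subset_card hMN y).1 (core_subset_card hMN y').1
  -- The cores in `S j` give the cluster at least `|S j| (1 - ε) N ^ i` points, while its density is
  -- below `1 - 2 ε ≤ (1 - ε) ^ 2`.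
  have hup : ∀ j, s < j → j ≤ W → ((S j).card : ℝ) / (N : ℝ) ^ j ≤ 1 - ε := by
    intro j hj1 hj2
    have h1 : ((S j).card : ℝ) * M ≤ (clus c (T.cball (i + j) x) x).card := by
      exact_mod_cast hcores j
    have h2 := (not_le.1 (hW j hj1 hj2)).le
    have hNi : (0 : ℝ) < (N : ℝ) ^ i := by positivity
    have hNj : (0 : ℝ) < (N : ℝ) ^ j := by positivity
    rw [div_le_iff₀ hNj]
    rw [pow_add] at h2
    have h3 : ((S j).card : ℝ) * ((1 - ε) * (N : ℝ) ^ i) ≤ (S j).card * M := by gcongr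
    have h4 : (N : ℝ) ^ i * (((S j).card : ℝ) * (1 - ε)) ≤
        (N : ℝ) ^ i * ((1 - 2 * ε) * (N : ℝ) ^ j) := by nlinarith
    have h5 := le_of_mul_le_mul_left h4 hNi
    have h6 : (1 - 2 * ε) * (N : ℝ) ^ j ≤ ((1 - ε) * (N : ℝ) ^ j) * (1 - ε) := by
      nlinarith [mul_nonneg (sq_nonneg ε) hNj.le]
    exact le_of_mul_le_mul_right (h5.trans h6) (by linarith)
  -- Of the density `1 - 2 ε` at level `s`, at most `ε` lies in bad balls and at most `ε` outside
  -- the cores.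
  have hlow : 1 - 4 * ε ≤ ((S s).card : ℝ) / (N : ℝ) ^ s := by
    set C := clus c (T.cball (i + s) x) x with hC
    have hNi : (0 : ℝ) < (N : ℝ) ^ i := by positivity
    have hNs : (0 : ℝ) < (N : ℝ) ^ s := by positivity
    have h1 : C ⊆ (S s).biUnion (T.ball i) ∪ A.biUnion (T.ball i) ∪
        (T.cball s u).biUnion fun y => T.ball i y \ core T i M o c y := by
      intro z hz
      have hz' : z ∈ T.cball (i + s) x := clus_subset hz
      rw [hball, Finset.mem_biUnion] at hz'
      obtain ⟨y, hy, hzy⟩ := hz'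
      simp only [Finset.mem_union, Finset.mem_biUnion, Finset.mem_sdiff]
      by_cases hzc : z ∈ core T i M o c y
      · left
        by_cases hg : c' s(y, y) = true
        · exact Or.inl ⟨y, (hmemS s y).2 ⟨hy, hg, z, hzc, mem_clus.1 hz⟩, hzy⟩
        · exact Or.inr ⟨y, Finset.mem_filter.2 ⟨T.cball_mono hsW u hy, by simpa using hg⟩, hzy⟩
      · exact Or.inr ⟨y, hy, hzy, hzc⟩
    have h2 : C.card ≤ (S s).card * N ^ i + A.card * N ^ i + N ^ s * (N ^ i - M) := by
      refine (Finset.card_le_card h1).trans ((Finset.card_union_le _ _).trans ?_)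
      refine Nat.add_le_add ((Finset.card_union_le _ _).trans (Nat.add_le_add ?_ ?_)) ?_
      · exact Finset.card_biUnion_le_card_mul _ _ _ fun y _ => (T.card_ball i y).le
      · exact Finset.card_biUnion_le_card_mul _ _ _ fun y _ => (T.card_ball i y).le
      · rw [← T.card_cball s u]
        refine Finset.card_biUnion_le_card_mul _ _ _ fun y _ => ?_
        rw [Finset.card_sdiff_of_subset (core_subset_card hMN y).1, T.card_ball,
          (core_subset_card hMN y).2]
    have h3 : (C.card : ℝ) ≤ (S s).card * (N : ℝ) ^ i + A.card * (N : ℝ) ^ i +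
        (N : ℝ) ^ s * ((N : ℝ) ^ i - M) := by
      have : ((N ^ i - M : ℕ) : ℝ) = (N : ℝ) ^ i - M := by
        rw [Nat.cast_sub hMN]; push_cast; rfl
      rw [← this]
      exact_mod_cast h2
    have h4 : (1 - 2 * ε) * (N : ℝ) ^ (i + s) ≤ C.card := hs
    have h5 : (A.card : ℝ) ≤ ε * (N : ℝ) ^ s := by
      have h6 := hAe s le_rfl
      have h7 : (r : ℝ) / (N : ℝ) ^ s ≤ ε := by
        have : (0 : ℝ) ≤ r / (N : ℝ) ^ s := by positivity
        have hK : (0 : ℝ) ≤ K := by positivity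
        nlinarith
      rw [← div_le_iff₀ hNs]
      exact h6.trans h7
    rw [le_div_iff₀ hNs]
    refine le_of_mul_le_mul_right ?_ hNi
    rw [pow_add] at h4
    have h8 : (N : ℝ) ^ s * ((N : ℝ) ^ i - M) ≤ (N : ℝ) ^ s * (ε * (N : ℝ) ^ i) := by
      gcongr; linarith
    have h9 : (A.card : ℝ) * (N : ℝ) ^ i ≤ (ε * (N : ℝ) ^ s) * (N : ℝ) ^ i := by gcongr
    nlinarith
  refine sum_weight_ge_of_lost (ρ := fun j => ((S j).card : ℝ) / (N : ℝ) ^ j) (K := K)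
    (e := r / (N : ℝ) ^ s) hWK hε0 (by positivity) ?_ (closedWeight_nonneg T c' u) ?_ ?_ hlow hup
  · have : (0 : ℝ) ≤ r / (N : ℝ) ^ s := by positivity
    linarith
  · intro j h1 h2
    have := (hstep j h1 h2).1
    have := hAe j h1
    linarith
  · intro j h1 h2
    have := (hstep j h1 h2).2
    have := hAe j h1
    linarith

/-- Coarsen at level `i`. Either more than `r` of the `N ^ W` coarse sites are closed, each having
probability at most `γ / ε`, or the loss forces a large closed weight. Cores of density `1 - ε`
reduce the intensity `Λ` to `Λ (1 - ε) ^ 2`. -/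
theorem Perc.real_lost_le [IsProbabilityMeasure μ] (hX : Perc T μ X p J) (hN : 2 ≤ N) {ε Λ γ : ℝ}
    {i s W K r : ℕ} (hε0 : 0 < ε) (hε : ε ≤ 1 / 20) (hΛ : 0 ≤ Λ) (hWK : W ≤ s + K) (hsW : s ≤ W)
    (hr : (K + 1) * (r / (N : ℝ) ^ s) ≤ ε / 4)
    (hJ : ∀ j, i + s < j → j ≤ i + W → Λ * ((N : ℝ) / (N : ℝ) ^ (2 * j)) ≤ J j)
    (hγ : ∀ x, μ.real {ω | ¬ IsBig T (1 - 2 * ε) (conf X ω) i x} ≤ γ) (x : V) :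
    μ.real {ω | IsBig T (1 - 2 * ε) (conf X ω) (i + s) x ∧
        ∀ j, s < j → j ≤ W → ¬ IsBig T (1 - 2 * ε) (conf X ω) (i + j) x} ≤
      ((N : ℝ) ^ W * (γ / ε)) ^ (r + 1) + 2 ^ pairCount N s W *
        Real.exp (-(Λ * (1 - ε) ^ 2 * min (1 - 6 * ε) ((W - s : ℕ) * (ε / 2) - ε / 4))) := by
  have hN0 : (0 : ℝ) < N := by positivity
  have hNi : (0 : ℝ) < (N : ℝ) ^ i := by positivity
  set M := ⌈(1 - ε) * (N : ℝ) ^ i⌉₊ with hMdef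
  have hM1 : (1 - ε) * (N : ℝ) ^ i ≤ M := Nat.le_ceil _
  have hM2 : (M : ℝ) < (1 - ε) * (N : ℝ) ^ i + 1 :=
    Nat.ceil_lt_add_one (mul_nonneg (by linarith) hNi.le)
  have hMN : M ≤ N ^ i := by
    rw [hMdef, Nat.ceil_le]
    push_cast
    nlinarith
  have hγ0 : 0 ≤ γ := measureReal_nonneg.trans (hγ x)
  have hX' := hX.renormalize (o := x) hMN
    (hX.real_not_isGood_le (by omega) (by linarith) hε0 hM2 hγ)
  set u := T.up^[i] x with hu
  set X' : Sym2 V → Ω → Bool := fun e ω => ren T i M x (conf X ω) e with hX'def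
  have h1 := hX'.real_closedSites (by positivity) (T.cball W u) r
  rw [T.card_cball] at h1
  have h2 := hX'.real_closedWeight_ge (s := s) (W := W) (Λ := Λ * (1 - ε) ^ 2)
    (h := min (1 - 6 * ε) ((W - s : ℕ) * (ε / 2) - ε / 4)) (by positivity) (fun j hj1 hj2 => by
      have h3 := hJ (i + (j + 1)) (by omega) (by omega)
      have h4 : ((1 - ε) * (N : ℝ) ^ i) ^ 2 ≤ (M : ℝ) ^ 2 :=
        pow_le_pow_left₀ (mul_nonneg (by linarith) hNi.le) hM1 2
      have h5 : (0 : ℝ) ≤ Λ * ((N : ℝ) / (N : ℝ) ^ (2 * (i + (j + 1)))) := by positivity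
      calc Λ * (1 - ε) ^ 2 * ((N : ℝ) / (N : ℝ) ^ (2 * (j + 1))) =
            ((1 - ε) * (N : ℝ) ^ i) ^ 2 * (Λ * ((N : ℝ) / (N : ℝ) ^ (2 * (i + (j + 1))))) := by
              have : (N : ℝ) ^ (2 * (i + (j + 1))) = ((N : ℝ) ^ i) ^ 2 * (N : ℝ) ^ (2 * (j + 1)) := by
                ring
              rw [this]; field_simp
        _ ≤ (M : ℝ) ^ 2 * (Λ * ((N : ℝ) / (N : ℝ) ^ (2 * (i + (j + 1))))) := by gcongr
        _ ≤ _ := by gcongr) u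
  refine le_trans ?_ (add_le_add (by exact_mod_cast h1) h2)
  refine le_trans (measureReal_mono ?_ (measure_ne_top _ _)) (measureReal_union_le _ _)
  rintro ω ⟨hω1, hω2⟩
  by_cases hA : ((T.cball W u).filter fun y => X' s(y, y) ω = false).card ≤ r
  · exact Or.inr (closedWeight_ge_of_lost hN hε0 hε hWK hsW hM1 hMN hr hA hω1 hω2)
  · exact Or.inl (not_le.1 hA)

end Window

/-! ### Induction over the levels of a block -/

section Block

variable {V Ω : Type} {N : ℕ} [MeasurableSpace Ω] {T : HTree V N} {μ : Measure Ω}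
    {X : Sym2 V → Ω → Bool} {p : ℝ} {J : ℕ → ℝ}

theorem pairCount_mono {N i s : ℕ} (h : i ≤ s) : pairCount N 0 i ≤ pairCount N 0 s :=
  Finset.sum_le_sum_of_subset (Finset.Ico_subset_Ico_right h)

/-- The bound on the probability of losing contact with the giant cluster. -/
def lossBound (N s W r : ℕ) (ε Λ γ h : ℝ) : ℝ :=
  ((N : ℝ) ^ W * (γ / ε)) ^ (r + 1) + 2 ^ pairCount N s W * Real.exp (-(Λ * (1 - ε) ^ 2 * h))

theorem lossBound_nonneg {N s W r : ℕ} {ε Λ γ h : ℝ} (hε : 0 ≤ ε) (hγ : 0 ≤ γ) :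
    0 ≤ lossBound N s W r ε Λ γ h := by unfold lossBound; positivity

theorem Perc.real_tainted_le [IsProbabilityMeasure μ] (hX : Perc T μ X p J) (s : ℕ) (x : V) :
    μ.real {ω | ∃ y ∈ T.cball s x, X s(y, y) ω = false} ≤ (N : ℝ) ^ s * p := by
  have h1 : {ω | ∃ y ∈ T.cball s x, X s(y, y) ω = false} =
      ⋃ y ∈ T.cball s x, {ω | X s(y, y) ω = false} := by ext ω; simp
  rw [h1]
  refine (measureReal_biUnion_finset_le _ _).trans ((Finset.sum_le_sum fun y _ => hX.site y).trans ?_)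
  rw [Finset.sum_const, T.card_cball, nsmul_eq_mul]
  push_cast; rfl

/-- Points far from closed sites belong to a big cluster with high probability, at all levels. -/
theorem Perc.real_untainted_not_isBig_le [IsProbabilityMeasure μ] (hX : Perc T μ X p J)
    (hN : 2 ≤ N) {ε Λ γ₀ γ : ℝ} {s K r k : ℕ} (hε0 : 0 < ε) (hε : ε ≤ 1 / 20) (hΛ : 0 ≤ Λ)
    (hK : 2 ≤ K * ε) (hr : (K + 1) * (r / (N : ℝ) ^ s) ≤ ε / 4)
    (hJ : ∀ j, 0 < j → j ≤ k → Λ * ((N : ℝ) / (N : ℝ) ^ (2 * j)) ≤ J j)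
    (hγ0 : 0 ≤ γ₀) (hp0 : 0 ≤ p) (hγ : γ = (N : ℝ) ^ s * p + γ₀)
    (hsum : 2 ^ pairCount N 0 s * Real.exp (-(Λ * (2 * ε))) +
      k * lossBound N s (s + K) r ε Λ γ (1 - 6 * ε) +
      K * lossBound N s (s + 1) r ε Λ γ (ε / 4) ≤ γ₀) {i : ℕ} (hi : i ≤ k) (x : V) :
    μ.real {ω | ¬ IsBig T (1 - 2 * ε) (conf X ω) i x ∧
      ∀ y ∈ T.cball s x, X s(y, y) ω = true} ≤ γ₀ := by
  have hγ1 : 0 ≤ γ := by rw [hγ]; positivity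
  have hK1 : 1 ≤ K := by
    rcases Nat.eq_zero_or_pos K with rfl | h
    · norm_num at hK
    · exact h
  have hE1 : 0 ≤ lossBound N s (s + K) r ε Λ γ (1 - 6 * ε) := lossBound_nonneg hε0.le hγ1
  have hE2 : 0 ≤ lossBound N s (s + 1) r ε Λ γ (ε / 4) := lossBound_nonneg hε0.le hγ1
  have hbase : ∀ i, i ≤ s → i ≤ k → ∀ x, μ.real {ω | ¬ IsBig T (1 - 2 * ε) (conf X ω) i x ∧
      ∀ y ∈ T.cball s x, X s(y, y) ω = true} ≤
      2 ^ pairCount N 0 s * Real.exp (-(Λ * (2 * ε))) := by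
    intro i his hik x
    refine (measureReal_mono (s₂ := {ω | 2 * ε ≤ ∑ j ∈ Finset.Ico 0 i,
      closedWeight T (conf X ω) x j}) ?_ (measure_ne_top _ _)).trans
      ((hX.real_closedWeight_ge hΛ (fun j _ hj => hJ (j + 1) (by omega) (by omega)) x).trans ?_)
    · rintro ω ⟨h1, h2⟩
      have := closedWeight_ge_of_open hN (fun y hy => h2 y (T.cball_mono his x hy)) h1
      change 2 * ε ≤ _
      linarith
    · gcongr
      · norm_num
      · exact pairCount_mono his
  induction i using Nat.strong_induction_on generalizing x with
  | _ i ih =>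
    have hk0 : (0 : ℝ) ≤ k * lossBound N s (s + K) r ε Λ γ (1 - 6 * ε) := by positivity
    have hk1 : (0 : ℝ) ≤ K * lossBound N s (s + 1) r ε Λ γ (ε / 4) := by positivity
    rcases le_or_gt i s with his | his
    · exact (hbase i his hi x).trans (by linarith)
    -- Allowing closed sites in the `s`-ball costs `N ^ s * p`. This unconditional bound is the
    -- input for coarsening at level `j - s`.
    have hprev : ∀ j, j < i → ∀ x, μ.real {ω | ¬ IsBig T (1 - 2 * ε) (conf X ω) j x} ≤ γ := by
      intro j hj x
      rw [hγ]
      refine le_trans ?_ (add_le_add (hX.real_tainted_le s x) (ih j hj (by omega) x))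
      refine (measureReal_mono ?_ (measure_ne_top _ _)).trans (measureReal_union_le _ _)
      intro ω hω
      by_cases h : ∀ y ∈ T.cball s x, X s(y, y) ω = true
      · exact Or.inr ⟨hω, h⟩
      · push Not at h
        obtain ⟨y, hy, h⟩ := h
        exact Or.inl ⟨y, hy, by simpa using h⟩
    -- A window of `K` levels costs the full `1 - 6 ε`, because `2 ≤ K ε`. When it does not fit
    -- below `i`, a single level with cost `ε / 4` is used; this happens for at most `K` values of
    -- `j`.
    let L : ℕ → ℕ := fun j => if j + K ≤ i then K else 1
    let lost : ℕ → Set Ω := fun j => {ω | IsBig T (1 - 2 * ε) (conf X ω) (j - s + s) x ∧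
        ∀ l, s < l → l ≤ s + L j → ¬ IsBig T (1 - 2 * ε) (conf X ω) (j - s + l) x}
    have hlost : ∀ j ∈ Finset.Ico s i, μ.real (lost j) ≤
        lossBound N s (s + K) r ε Λ γ (1 - 6 * ε) +
        if j + K ≤ i then 0 else lossBound N s (s + 1) r ε Λ γ (ε / 4) := by
      intro j hj
      rw [Finset.mem_Ico] at hj
      have hL : L j ≤ K ∧ j + L j ≤ i := by
        simp only [L]; split_ifs <;> omega
      have h1 := hX.real_lost_le (i := j - s) (s := s) (W := s + L j) (K := K) (r := r) hN hε0 hε hΛ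
        (by omega) (by omega) hr (fun l h1 h2 => hJ l (by omega) (by omega))
        (hprev (j - s) (by omega)) x
      refine h1.trans ?_
      have hsub : s + L j - s = L j := by omega
      rw [hsub]
      by_cases hjK : j + K ≤ i
      · rw [if_pos hjK, add_zero]
        have : L j = K := if_pos hjK
        rw [this, min_eq_left (by linarith), lossBound]
      · rw [if_neg hjK]
        have : L j = 1 := if_neg hjK
        rw [this, Nat.cast_one, one_mul, min_eq_right (by linarith)]
        have : ε / 2 - ε / 4 = ε / 4 := by ring
        rw [this]
        exact le_add_of_nonneg_left hE1
    have hsub : {ω | ¬ IsBig T (1 - 2 * ε) (conf X ω) i x ∧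
        ∀ y ∈ T.cball s x, X s(y, y) ω = true} ⊆
        {ω | ¬ IsBig T (1 - 2 * ε) (conf X ω) s x ∧
          ∀ y ∈ T.cball s x, X s(y, y) ω = true} ∪ ⋃ j ∈ Finset.Ico s i, lost j := by
      rintro ω ⟨h1, h2⟩
      by_cases hs : IsBig T (1 - 2 * ε) (conf X ω) s x
      swap
      · exact Or.inl ⟨hs, h2⟩
      right
      set j := Nat.findGreatest (fun j => IsBig T (1 - 2 * ε) (conf X ω) j x) i with hj
      have hj1 : IsBig T (1 - 2 * ε) (conf X ω) j x :=
        Nat.findGreatest_spec (P := fun j => IsBig T (1 - 2 * ε) (conf X ω) j x) his.le hs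
      have hj2 : s ≤ j := Nat.le_findGreatest his.le hs
      have hj3 : j ≤ i := Nat.findGreatest_le i
      have hj4 : j ≠ i := by
        intro h; rw [h] at hj1; exact h1 hj1
      have hjK : j + L j ≤ i := by
        simp only [L]; split_ifs <;> omega
      simp only [Set.mem_iUnion, Finset.mem_Ico]
      refine ⟨j, ⟨hj2, by omega⟩, ?_, fun l hl1 hl2 => ?_⟩
      · rwa [Nat.sub_add_cancel hj2]
      · exact Nat.findGreatest_is_greatest (P := fun j => IsBig T (1 - 2 * ε) (conf X ω) j x)
          (n := i) (by omega) (by omega)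
    calc _ ≤ μ.real ({ω | ¬ IsBig T (1 - 2 * ε) (conf X ω) s x ∧
          ∀ y ∈ T.cball s x, X s(y, y) ω = true} ∪ ⋃ j ∈ Finset.Ico s i, lost j) :=
          measureReal_mono hsub (measure_ne_top _ _)
      _ ≤ _ := measureReal_union_le _ _
      _ ≤ 2 ^ pairCount N 0 s * Real.exp (-(Λ * (2 * ε))) + ∑ j ∈ Finset.Ico s i, μ.real (lost j) :=
          add_le_add (hbase s le_rfl (by omega) x) (measureReal_biUnion_finset_le _ _)
      _ ≤ _ := by
          refine le_trans ?_ hsum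
          rw [add_assoc]
          refine add_le_add_right ((Finset.sum_le_sum hlost).trans ?_) _
          rw [Finset.sum_add_distrib, Finset.sum_const, Nat.card_Ico, nsmul_eq_mul]
          refine add_le_add ?_ ?_
          · gcongr; omega
          · rw [Finset.sum_ite, Finset.sum_const_zero, zero_add, Finset.sum_const, nsmul_eq_mul]
            gcongr
            have : (Finset.Ico s i).filter (fun j => ¬ j + K ≤ i) ⊆ Finset.Ico (i - K) i := by
              intro j hj
              rw [Finset.mem_filter, Finset.mem_Ico] at hj
              rw [Finset.mem_Ico]
              omega
            have := Finset.card_le_card this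
            rw [Nat.card_Ico] at this
            omega

/-- Chebyshev for independent sites. A first-moment bound at the threshold `2 τ |B|` would only give
`1/2`, whereas a block may fail with probability at most `(2n) ^ (-c)`. -/
theorem Perc.real_many_closedSites_le [IsProbabilityMeasure μ] (hX : Perc T μ X p J) {τ : ℝ}
    (hτ : 0 < τ) (hp : p ≤ τ) {B : Finset V} (hB : B.Nonempty) :
    μ.real {ω | 2 * τ * B.card ≤ (B.filter fun y => X s(y, y) ω = false).card} ≤
      1 / (τ * B.card) := by
  let E : V → Set Ω := fun x => {ω | X s(x, x) ω = false}
  have hE : ∀ x, MeasurableSet (E x) := fun x => hX.meas _ (measurableSet_singleton false)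
  let f : V → Ω → ℝ := fun x => (E x).indicator fun _ => 1
  have hf : ∀ x, MemLp (f x) 2 μ := fun x => (memLp_const 1).indicator (hE x)
  have hint : ∀ x, ∫ ω, f x ω ∂μ = μ.real (E x) := by
    intro x
    simp only [f]
    rw [integral_indicator (hE x)]; simp
  have hvar : ∀ x, variance (f x) μ ≤ τ := by
    intro x
    refine (variance_le_expectation_sq (hf x).aestronglyMeasurable).trans ?_
    have : (f x) ^ 2 = f x := by
      ext ω
      by_cases h : ω ∈ E x <;> simp [f, h]
    rw [this, hint]
    exact (hX.site x).trans hp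
  have hindep : Set.Pairwise (B : Set V) fun x y => IndepFun (f x) (f y) μ := by
    intro x _ y _ hxy
    have h1 : IndepFun (X s(x, x)) (X s(y, y)) μ := hX.indep.indepFun (by simpa using hxy)
    have h2 : ∀ x, f x = (fun b : Bool => if b = false then (1 : ℝ) else 0) ∘ X s(x, x) := by
      intro x
      ext ω
      simp [f, E, Set.indicator]
    rw [h2 x, h2 y]
    exact h1.comp measurable_from_top measurable_from_top
  have hsum : variance (∑ x ∈ B, f x) μ ≤ B.card * τ := by
    rw [IndepFun.variance_sum (fun x _ => hf x) hindep]
    refine (Finset.sum_le_sum fun x _ => hvar x).trans ?_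
    rw [Finset.sum_const, nsmul_eq_mul]
  have hBc : (0 : ℝ) < B.card := by exact_mod_cast hB.card_pos
  have hmem : MemLp (∑ x ∈ B, f x) 2 μ := memLp_finsetSum' _ fun x _ => hf x
  have hmean : ∫ ω, (∑ x ∈ B, f x) ω ∂μ ≤ B.card * τ := by
    simp only [Finset.sum_apply]
    rw [integral_finsetSum _ fun x _ => (hf x).integrable (by norm_num)]
    refine (Finset.sum_le_sum fun x _ => (hint x).le.trans ((hX.site x).trans hp)).trans ?_
    rw [Finset.sum_const, nsmul_eq_mul]
  have hcheb := meas_ge_le_variance_div_sq hmem (c := τ * B.card) (by positivity)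
  have hcheb' : μ.real {ω | τ * B.card ≤ |(∑ x ∈ B, f x) ω - ∫ ω, (∑ x ∈ B, f x) ω ∂μ|} ≤
      variance (∑ x ∈ B, f x) μ / (τ * B.card) ^ 2 :=
    ENNReal.toReal_le_of_le_ofReal (div_nonneg (variance_nonneg _ _) (sq_nonneg _)) hcheb
  refine (measureReal_mono ?_ (measure_ne_top _ _)).trans (hcheb'.trans ?_)
  · intro ω hω
    have h1 : (∑ x ∈ B, f x) ω = (B.filter fun y => X s(y, y) ω = false).card := by
      simp [f, E, Set.indicator]
    change 2 * τ * B.card ≤ ((B.filter fun y => X s(y, y) ω = false).card : ℝ) at hω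
    change τ * B.card ≤ |(∑ x ∈ B, f x) ω - ∫ ω, (∑ x ∈ B, f x) ω ∂μ|
    rw [h1]
    refine le_trans ?_ (le_abs_self _)
    linarith
  · rw [div_le_div_iff₀ (by positivity) (by positivity)]
    have : 0 < τ * B.card := by positivity
    nlinarith

/-- The cluster structure of a whole block: most points of the block lie in big clusters. -/
theorem Perc.real_few_isBig_le [IsProbabilityMeasure μ] (hX : Perc T μ X p J) (hN : 0 < N)
    {θ γ₀ τ δ : ℝ} {s k M : ℕ} (hsk : s ≤ k) (hτ : 0 < τ) (hp : p ≤ τ) (hδ : 0 < δ)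
    (hbig : ∀ x, μ.real {ω | ¬ IsBig T θ (conf X ω) k x ∧
      ∀ y ∈ T.cball s x, X s(y, y) ω = true} ≤ γ₀)
    (hM : (M : ℝ) < (1 - (N : ℝ) ^ s * (2 * τ) - δ) * (N : ℝ) ^ k + 1) (y : V) :
    μ.real {ω | ¬ M ≤ ((T.ball k y).filter fun x => IsBig T θ (conf X ω) k x).card} ≤
      1 / (τ * (N : ℝ) ^ k) + γ₀ / δ := by
  set B := T.ball k y with hB
  have hBc : (B.card : ℝ) = (N : ℝ) ^ k := by rw [hB, T.card_ball]; push_cast; rfl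
  have hNk : (0 : ℝ) < (N : ℝ) ^ k := by positivity
  have hBn : B.Nonempty := by
    rw [← Finset.card_pos, hB, T.card_ball]; positivity
  let E : V → Set Ω := fun x => {ω | ¬ IsBig T θ (conf X ω) k x ∧
      ∀ y ∈ T.cball s x, X s(y, y) ω = true}
  have hE : ∀ x, MeasurableSet (E x) := by
    intro x
    refine (measurableSet_conf hX.meas (dependsOn_isBig T θ k x)).compl.inter ?_
    refine measurableSet_conf (P := fun c => ∀ y ∈ T.cball s x, c s(y, y) = true)
      (D := (T.cball s x).sym2) hX.meas fun c c' h => propext (forall₂_congr fun y hy => ?_)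
    rw [h s(y, y) (by simpa using hy)]
  have h1 := hX.real_many_closedSites_le hτ hp hBn
  have h2 := markov_count B hE (t := δ * (N : ℝ) ^ k) (fun x _ => hbig x) (by positivity)
  rw [hBc] at h1 h2
  have h3 : (N : ℝ) ^ k * γ₀ / (δ * (N : ℝ) ^ k) = γ₀ / δ := by field_simp
  rw [h3] at h2
  refine le_trans ?_ (add_le_add h1 h2)
  refine (measureReal_mono ?_ (measure_ne_top _ _)).trans (measureReal_union_le _ _)
  intro ω hω
  by_contra hcon
  rw [Set.mem_union, not_or] at hcon
  have hc1 : ((B.filter fun y => X s(y, y) ω = false).card : ℝ) < 2 * τ * (N : ℝ) ^ k :=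
    lt_of_not_ge hcon.1
  have hc2 : ((B.filter fun x => ω ∈ E x).card : ℝ) < δ * (N : ℝ) ^ k :=
    lt_of_not_ge fun h => hcon.2 (h.trans_eq (by congr))
  apply hω
  set C := B.filter fun y => X s(y, y) ω = false with hC
  -- A point without a big cluster either has a closed site in its `s`-ball or belongs to the rare
  -- set `E`; a closed site affects only `N ^ s` points.
  have hcover : B ⊆ (B.filter fun x => IsBig T θ (conf X ω) k x) ∪
      C.biUnion (fun z => T.cball s z) ∪ B.filter (fun x => ω ∈ E x) := by
    intro x hx
    simp only [Finset.mem_union, Finset.mem_filter, Finset.mem_biUnion]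
    by_cases hb : IsBig T θ (conf X ω) k x
    · exact Or.inl (Or.inl ⟨hx, hb⟩)
    by_cases ho : ∀ y ∈ T.cball s x, X s(y, y) ω = true
    · exact Or.inr ⟨hx, hb, ho⟩
    · push Not at ho
      obtain ⟨z, hz, ho⟩ := ho
      have hz' : T.up^[s] z = T.up^[s] x := T.mem_ball.1 hz
      refine Or.inl (Or.inr ⟨z, Finset.mem_filter.2 ⟨?_, by simpa using ho⟩, ?_⟩)
      · have h4 : z ∈ T.cball k x := T.cball_mono hsk x hz
        rwa [HTree.cball, T.mem_ball.1 hx] at h4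
      · rw [HTree.cball, hz']
        exact T.mem_ball_self s x
  have h4 := (Finset.card_le_card hcover).trans ((Finset.card_union_le _ _).trans
    (Nat.add_le_add_right (Finset.card_union_le _ _) _))
  have h5 : (C.biUnion (fun z => T.cball s z)).card ≤ C.card * N ^ s :=
    Finset.card_biUnion_le_card_mul _ _ _ fun z _ => (T.card_cball s z).le
  have h6 : (N : ℝ) ^ k ≤ (B.filter fun x => IsBig T θ (conf X ω) k x).card +
      C.card * (N : ℝ) ^ s + (B.filter (fun x => ω ∈ E x)).card := by
    rw [← hBc]
    exact_mod_cast h4.trans (by omega)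
  have h7 : (C.card : ℝ) * (N : ℝ) ^ s ≤ (2 * τ * (N : ℝ) ^ k) * (N : ℝ) ^ s := by gcongr
  have h8 := hc2
  have h9 : (M : ℝ) < (B.filter fun x => IsBig T θ (conf X ω) k x).card + 1 := by nlinarith
  exact Nat.lt_succ_iff.1 (by exact_mod_cast h9)

theorem exists_core_mem {θ : ℝ} (hθ : 1 / 2 < θ) (hN : 0 < N) {c : Sym2 V → Bool} {i M : ℕ}
    {y x : V} (hM : 0 < M) (hx : x ∈ T.ball i y) (hxb : IsBig T θ c i x)
    (h : M ≤ ((T.ball i y).filter fun x => IsBig T θ c i x).card) :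
    ∃ S, IsCore T i M (Conn c (T.ball i y)) y S ∧ x ∈ S := by
  obtain ⟨S, hxS, hS, hSc⟩ := Finset.exists_subsuperset_card_eq
    (Finset.singleton_subset_iff.2 (Finset.mem_filter.2 ⟨hx, hxb⟩)) (by rwa [Finset.card_singleton]) h
  refine ⟨S, ⟨hS.trans (Finset.filter_subset _ _), hSc, fun a ha b hb => ?_⟩,
    Finset.singleton_subset_iff.1 hxS⟩
  have ha' := Finset.mem_filter.1 (hS ha)
  have hb' := Finset.mem_filter.1 (hS hb)
  exact IsBig.conn hθ hN ha'.1 hb'.1 ha'.2 hb'.2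

end Block

/-! ### Decay exponents of the error terms -/

section Asymptotics

open Filter

theorem eventually_mul_rpow_le (C : ℝ) {a b : ℝ} (h : b < a) :
    ∀ᶠ n : ℕ in atTop, C * (n : ℝ) ^ (-a) ≤ (n : ℝ) ^ (-b) := by
  have h1 : Tendsto (fun n : ℕ => C * (n : ℝ) ^ (-(a - b))) atTop (nhds (C * 0)) :=
    ((tendsto_rpow_neg_atTop (sub_pos.2 h)).comp tendsto_natCast_atTop_atTop).const_mul C
  rw [mul_zero] at h1
  filter_upwards [h1.eventually_le_const one_pos, eventually_gt_atTop 0] with n hn hn0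
  have hn0' : (0 : ℝ) < n := by exact_mod_cast hn0
  calc C * (n : ℝ) ^ (-a) = (C * (n : ℝ) ^ (-(a - b))) * (n : ℝ) ^ (-b) := by
        rw [mul_assoc, ← Real.rpow_add hn0']; congr 2; ring
    _ ≤ 1 * (n : ℝ) ^ (-b) := by gcongr
    _ = _ := one_mul _

theorem exp_neg_mul_log_le {n : ℕ} (hn : 1 ≤ n) {x y : ℝ} (h : y ≤ x) :
    Real.exp (-(x * Real.log n)) ≤ (n : ℝ) ^ (-y) := by
  have hn' : (1 : ℝ) ≤ n := by exact_mod_cast hn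
  rw [Real.rpow_def_of_pos (by linarith)]
  apply Real.exp_le_exp.2
  nlinarith [mul_le_mul_of_nonneg_right h (Real.log_nonneg hn')]

/-- Having `r + 1` bad coarse sites costs `n ^ (-c (r + 1)) ≤ n ^ (-2)`, which survives the factor
`n` from the union over levels. -/
theorem pow_loss_le {n r : ℕ} (hn : 1 ≤ n) {c D γ ε A : ℝ} (hγ0 : 0 ≤ γ) (hε : 0 < ε) (hA : 0 ≤ A)
    (hγ : γ ≤ D * (n : ℝ) ^ (-c)) (hr : 2 ≤ c * (r + 1)) :
    (A * (γ / ε)) ^ (r + 1) ≤ (A * (D / ε)) ^ (r + 1) * (n : ℝ) ^ (-2 : ℝ) := by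
  have hn' : (1 : ℝ) ≤ n := by exact_mod_cast hn
  have hn0 : (0 : ℝ) < n := by linarith
  calc (A * (γ / ε)) ^ (r + 1) ≤ (A * (D * (n : ℝ) ^ (-c) / ε)) ^ (r + 1) := by gcongr
    _ = (A * (D / ε)) ^ (r + 1) * ((n : ℝ) ^ (-c)) ^ (r + 1) := by
        rw [← mul_pow]; congr 1; ring
    _ ≤ _ := by
        have hD : 0 ≤ D := by
          by_contra hD
          have : D * (n : ℝ) ^ (-c) < 0 := mul_neg_of_neg_of_pos (not_le.1 hD) (by positivity)
          linarith
        refine mul_le_mul_of_nonneg_left ?_ (by positivity)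
        rw [← Real.rpow_natCast, ← Real.rpow_mul hn0.le]
        apply Real.rpow_le_rpow_of_exponent_le hn'
        push_cast; linarith

/-- Each of the five terms is at most a fifth of `n ^ (-4c)`. The critical one is `n * n ^ (-(1 +
ε)) = n ^ (-ε)`, which needs `hεb`, that is, `b` above `1` with room to spare. -/
theorem sum_lossBound_le {N n s K r : ℕ} {b c D ε γ : ℝ} (hn1 : 1 ≤ n) (hb : 1 < b)
    (hε0 : 0 < ε) (hε20 : ε ≤ 1 / 20) (hεb : 1 + ε ≤ b * ((1 - ε) ^ 2 * (1 - 6 * ε)))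
    (hγ0 : 0 ≤ γ) (hγD : γ ≤ D * (n : ℝ) ^ (-c)) (hr : 2 ≤ c * (r + 1))
    (e1 : 5 * 2 ^ pairCount N 0 s * (n : ℝ) ^ (-(2 * ε)) ≤ (n : ℝ) ^ (-(4 * c)))
    (e2 : 5 * (((N : ℝ) ^ (s + K) * (D / ε)) ^ (r + 1)) * (n : ℝ) ^ (-1 : ℝ) ≤
      (n : ℝ) ^ (-(4 * c)))
    (e3 : 5 * 2 ^ pairCount N s (s + K) * (n : ℝ) ^ (-ε) ≤ (n : ℝ) ^ (-(4 * c)))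
    (e4 : 5 * (K * ((N : ℝ) ^ (s + 1) * (D / ε)) ^ (r + 1)) * (n : ℝ) ^ (-2 : ℝ) ≤
      (n : ℝ) ^ (-(4 * c)))
    (e5 : 5 * (K * 2 ^ pairCount N s (s + 1)) * (n : ℝ) ^ (-(ε / 8)) ≤ (n : ℝ) ^ (-(4 * c))) :
    2 ^ pairCount N 0 s * Real.exp (-(b * Real.log n * (2 * ε))) +
      n * lossBound N s (s + K) r ε (b * Real.log n) γ (1 - 6 * ε) +
      K * lossBound N s (s + 1) r ε (b * Real.log n) γ (ε / 4) ≤ (n : ℝ) ^ (-(4 * c)) := by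
  have hn0' : (0 : ℝ) < n := by exact_mod_cast hn1
  have hK0 : (0 : ℝ) ≤ K := by positivity
  have t1 : Real.exp (-(b * Real.log n * (2 * ε))) ≤ (n : ℝ) ^ (-(2 * ε)) := by
    have : b * Real.log n * (2 * ε) = (b * (2 * ε)) * Real.log n := by ring
    rw [this]
    exact exp_neg_mul_log_le hn1 (by nlinarith)
  have t2 := pow_loss_le hn1 hγ0 hε0 (by positivity : (0 : ℝ) ≤ (N : ℝ) ^ (s + K)) hγD hr
  have t3 : Real.exp (-(b * Real.log n * (1 - ε) ^ 2 * (1 - 6 * ε))) ≤ (n : ℝ) ^ (-(1 + ε)) := by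
    have : b * Real.log n * (1 - ε) ^ 2 * (1 - 6 * ε) =
        (b * ((1 - ε) ^ 2 * (1 - 6 * ε))) * Real.log n := by ring
    rw [this]
    exact exp_neg_mul_log_le hn1 hεb
  have t4 := pow_loss_le hn1 hγ0 hε0 (by positivity : (0 : ℝ) ≤ (N : ℝ) ^ (s + 1)) hγD hr
  have t5 : Real.exp (-(b * Real.log n * (1 - ε) ^ 2 * (ε / 4))) ≤ (n : ℝ) ^ (-(ε / 8)) := by
    have : b * Real.log n * (1 - ε) ^ 2 * (ε / 4) =
        (b * ((1 - ε) ^ 2 * (ε / 4))) * Real.log n := by ring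
    rw [this]
    refine exp_neg_mul_log_le hn1 ?_
    have h1 : 1 / 2 ≤ (1 - ε) ^ 2 := by nlinarith
    have h2 : 1 / 2 * (ε / 4) ≤ (1 - ε) ^ 2 * (ε / 4) := by gcongr
    have h3 := mul_le_mul_of_nonneg_right hb.le (by positivity : 0 ≤ (1 - ε) ^ 2 * (ε / 4))
    linarith
  have t6 : (n : ℝ) * (n : ℝ) ^ (-2 : ℝ) = (n : ℝ) ^ (-1 : ℝ) := by
    rw [← Real.rpow_one_add' hn0'.le (by norm_num)]; norm_num
  have t7 : (n : ℝ) * (n : ℝ) ^ (-(1 + ε)) = (n : ℝ) ^ (-ε) := by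
    rw [← Real.rpow_one_add' hn0'.le (by linarith)]; congr 1; ring
  unfold lossBound
  have hP0 : (0 : ℝ) ≤ 2 ^ pairCount N 0 s := by positivity
  have hP1 : (0 : ℝ) ≤ 2 ^ pairCount N s (s + K) := by positivity
  have hP2 : (0 : ℝ) ≤ 2 ^ pairCount N s (s + 1) := by positivity
  generalize (2 : ℝ) ^ pairCount N 0 s = P0 at *
  generalize (2 : ℝ) ^ pairCount N s (s + K) = P1 at *
  generalize (2 : ℝ) ^ pairCount N s (s + 1) = P2 at *
  generalize ((N : ℝ) ^ (s + K) * (D / ε)) ^ (r + 1) = Q1 at *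
  generalize ((N : ℝ) ^ (s + 1) * (D / ε)) ^ (r + 1) = Q2 at *
  generalize ((N : ℝ) ^ (s + K) * (γ / ε)) ^ (r + 1) = R1 at *
  generalize ((N : ℝ) ^ (s + 1) * (γ / ε)) ^ (r + 1) = R2 at *
  generalize Real.exp (-(b * Real.log n * (2 * ε))) = E1 at *
  generalize Real.exp (-(b * Real.log n * (1 - ε) ^ 2 * (1 - 6 * ε))) = E3 at *
  generalize Real.exp (-(b * Real.log n * (1 - ε) ^ 2 * (ε / 4))) = E5 at *
  have u1 := mul_le_mul_of_nonneg_left t1 hP0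
  have u2 := mul_le_mul_of_nonneg_left t2 hn0'.le
  have u3 := mul_le_mul_of_nonneg_left (mul_le_mul_of_nonneg_left t3 hP1) hn0'.le
  have u4 := mul_le_mul_of_nonneg_left t4 hK0
  have u5 := mul_le_mul_of_nonneg_left (mul_le_mul_of_nonneg_left t5 hP2) hK0
  rw [mul_left_comm, t6] at u2
  rw [mul_left_comm (n : ℝ) P1 ((n : ℝ) ^ (-(1 + ε))), t7] at u3
  rw [mul_add, mul_add]
  linarith

end Asymptotics

/-! ### One block of renormalization -/

theorem sq_le_two_pow {n : ℕ} (hn : 4 ≤ n) : n ^ 2 ≤ 2 ^ n := by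
  induction n, hn using Nat.le_induction with
  | base => norm_num
  | succ n hn ih => rw [pow_succ 2]; nlinarith

/-- The size of the cluster to be found in a block. -/
def blockSize (N n : ℕ) (δ : ℝ) : ℕ := ⌈(1 - δ) * (N : ℝ) ^ n⌉₊

/-- One block of renormalization: at density `b log n` with `b > 1`, a ball of level `n` contains a
cluster of almost full density, with probability close to one. -/
theorem exists_block {N : ℕ} (hN : 2 ≤ N) {b : ℝ} (hb : 1 < b) :
    ∃ c : ℝ, 0 < c ∧ ∃ n₀ : ℕ, ∀ n ≥ n₀, ∀ (V Ω : Type) [MeasurableSpace Ω] (T : HTree V N)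
      (μ : Measure Ω) [IsProbabilityMeasure μ] (X : Sym2 V → Ω → Bool) (J : ℕ → ℝ),
      Perc T μ X ((n : ℝ) ^ (-c)) J →
      (∀ j, 0 < j → j ≤ n → b * Real.log n * ((N : ℝ) / (N : ℝ) ^ (2 * j)) ≤ J j) →
      (∀ y, μ.real {ω | ¬ IsGood T n (blockSize N n ((n : ℝ) ^ (-(c / 2)))) (conf X ω) y} ≤
        ((2 * n : ℕ) : ℝ) ^ (-c)) ∧
      ∀ y, ∀ x ∈ T.ball n y, μ.real {ω | ¬ ∃ S, IsCore T n (blockSize N n ((n : ℝ) ^ (-(c / 2))))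
        (Conn (conf X ω) (T.ball n y)) y S ∧ x ∈ S} ≤ (n : ℝ) ^ (-(c / 2)) := by
  obtain ⟨ε, hε0, hε20, hεb⟩ : ∃ ε : ℝ, 0 < ε ∧ ε ≤ 1 / 20 ∧
      1 + ε ≤ b * ((1 - ε) ^ 2 * (1 - 6 * ε)) := by
    -- Since `(1 - ε) ^ 2 (1 - 6 ε) ≥ 1 - 9 ε`, it is enough that `1 + ε ≤ b (1 - 9 ε)`.
    refine ⟨min (1 / 20) ((b - 1) / (9 * b + 1)), lt_min (by norm_num)
      (div_pos (by linarith) (by linarith)), min_le_left _ _, ?_⟩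
    set ε := min (1 / 20 : ℝ) ((b - 1) / (9 * b + 1)) with hε
    have h0 : 0 < ε := lt_min (by norm_num) (div_pos (by linarith) (by linarith))
    have h1 : ε ≤ 1 / 20 := min_le_left _ _
    have h2 : ε ≤ (b - 1) / (9 * b + 1) := min_le_right _ _
    rw [le_div_iff₀ (by linarith)] at h2
    have h3 : 1 - 9 * ε ≤ (1 - ε) ^ 2 * (1 - 6 * ε) := by nlinarith [sq_nonneg ε]
    have h4 := mul_le_mul_of_nonneg_left h3 (by linarith : 0 ≤ b)
    nlinarith
  -- Makes `4c` smaller than each of the exponents `2 ε`, `1`, `ε`, `2`, `ε / 8` in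
  -- `sum_lossBound_le`.
  set c : ℝ := ε / 64 with hc
  have hc0 : 0 < c := by positivity
  obtain ⟨r, hr⟩ : ∃ r : ℕ, 2 ≤ c * (r + 1) := by
    obtain ⟨r, hr⟩ := exists_nat_ge (2 / c)
    refine ⟨r, ?_⟩
    rw [div_le_iff₀ hc0] at hr
    nlinarith
  obtain ⟨K, hK⟩ : ∃ K : ℕ, 2 ≤ K * ε := by
    obtain ⟨K, hK⟩ := exists_nat_ge (2 / ε)
    exact ⟨K, by rwa [div_le_iff₀ hε0] at hK⟩
  -- Chosen after `r` and `K`: among `N ^ s` coarse balls, `r` bad ones are negligible even when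
  -- counted over `K` levels.
  obtain ⟨s, hs⟩ : ∃ s : ℕ, (K + 1) * (r / (N : ℝ) ^ s) ≤ ε / 4 := by
    have hN1 : (1 : ℝ) < N := by exact_mod_cast (by omega : 1 < N)
    obtain ⟨s, hs⟩ := pow_unbounded_of_one_lt ((K + 1) * r / (ε / 4)) hN1
    refine ⟨s, ?_⟩
    rw [div_lt_iff₀ (by positivity)] at hs
    rw [← mul_div_assoc, div_le_iff₀ (by positivity)]
    linarith
  set D : ℝ := (N : ℝ) ^ s + 1 with hD
  have hev := (Filter.eventually_ge_atTop (max s 4)).and <|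
    (eventually_mul_rpow_le (5 * 2 ^ pairCount N 0 s) (a := 2 * ε) (b := 4 * c)
      (by rw [hc]; linarith)).and <|
    (eventually_mul_rpow_le (5 * (((N : ℝ) ^ (s + K) * (D / ε)) ^ (r + 1))) (a := 1) (b := 4 * c)
      (by rw [hc]; linarith)).and <|
    (eventually_mul_rpow_le (5 * 2 ^ pairCount N s (s + K)) (a := ε) (b := 4 * c)
      (by rw [hc]; linarith)).and <|
    (eventually_mul_rpow_le (5 * (K * ((N : ℝ) ^ (s + 1) * (D / ε)) ^ (r + 1))) (a := 2)
      (b := 4 * c) (by rw [hc]; linarith)).and <|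
    (eventually_mul_rpow_le (5 * (K * 2 ^ pairCount N s (s + 1))) (a := ε / 8) (b := 4 * c)
      (by rw [hc]; linarith)).and <|
    (eventually_mul_rpow_le (2 * D) (a := c) (b := c / 2) (by linarith)).and <|
    (eventually_mul_rpow_le (2 * (2 : ℝ) ^ c) (a := 1) (b := c) (by rw [hc]; linarith)).and
    (eventually_mul_rpow_le (2 * (2 : ℝ) ^ c) (a := 2 * c) (b := c) (by linarith))
  obtain ⟨n₀, hn₀⟩ := Filter.eventually_atTop.1 hev
  refine ⟨c, hc0, n₀, ?_⟩
  intro n hn V Ω _ T μ _ X J hX hJ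
  obtain ⟨e0, e1, e2, e3, e4, e5, e6, e7, e8⟩ := hn₀ n hn
  have hsn : s ≤ n := (le_max_left _ _).trans e0
  have hn4 : 4 ≤ n := (le_max_right _ _).trans e0
  have hn1 : 1 ≤ n := by omega
  have hn1' : (1 : ℝ) ≤ n := by exact_mod_cast hn1
  have hn0' : (0 : ℝ) < n := by linarith
  have hlog : 0 ≤ Real.log n := Real.log_nonneg hn1'
  have hNs : (0 : ℝ) < (N : ℝ) ^ s := by positivity
  have hNn : (0 : ℝ) < (N : ℝ) ^ n := by positivity
  set γ₀ : ℝ := (n : ℝ) ^ (-(4 * c)) with hγ₀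
  set γ : ℝ := (N : ℝ) ^ s * (n : ℝ) ^ (-c) + γ₀ with hγ
  have hγ₀0 : 0 ≤ γ₀ := by positivity
  have hγ0 : 0 ≤ γ := by positivity
  have hγ₀c : γ₀ ≤ (n : ℝ) ^ (-c) :=
    Real.rpow_le_rpow_of_exponent_le hn1' (by linarith)
  have hγD : γ ≤ D * (n : ℝ) ^ (-c) := by rw [hγ, hD]; linarith
  set Λ : ℝ := b * Real.log n with hΛ
  have hΛ0 : 0 ≤ Λ := by positivity
  have hsum : 2 ^ pairCount N 0 s * Real.exp (-(Λ * (2 * ε))) +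
      n * lossBound N s (s + K) r ε Λ γ (1 - 6 * ε) +
      K * lossBound N s (s + 1) r ε Λ γ (ε / 4) ≤ γ₀ :=
    sum_lossBound_le hn1 hb hε0 hε20 hεb hγ0 hγD hr e1 e2 e3 e4 e5
  have hbig : ∀ x, μ.real {ω | ¬ IsBig T (1 - 2 * ε) (conf X ω) n x ∧
      ∀ y ∈ T.cball s x, X s(y, y) ω = true} ≤ γ₀ := fun x =>
    hX.real_untainted_not_isBig_le hN hε0 hε20 hΛ0 hK hs hJ hγ₀0 (by positivity) hγ hsum le_rfl x
  set M := blockSize N n ((n : ℝ) ^ (-(c / 2))) with hM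
  have hδ1 : (n : ℝ) ^ (-(c / 2)) < 1 := by
    apply Real.rpow_lt_one_of_one_lt_of_neg
    · exact_mod_cast (by omega : 1 < n)
    · linarith
  have hM1 : 0 < M := by
    rw [hM, blockSize, Nat.ceil_pos]
    exact mul_pos (by linarith) hNn
  -- The allowance `n ^ (-c/2)` in the density absorbs the share `2 N ^ s n ^ (-c)` near closed
  -- sites and the Markov threshold `n ^ (-2c)`.
  have hMlt : (M : ℝ) < (1 - (N : ℝ) ^ s * (2 * (n : ℝ) ^ (-c)) - (n : ℝ) ^ (-(2 * c))) *
      (N : ℝ) ^ n + 1 := by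
    refine (Nat.ceil_lt_add_one (mul_nonneg (by linarith) hNn.le)).trans_le ?_
    have h1 : (n : ℝ) ^ (-(2 * c)) ≤ (n : ℝ) ^ (-c) :=
      Real.rpow_le_rpow_of_exponent_le hn1' (by linarith)
    have h2 : (0 : ℝ) ≤ (n : ℝ) ^ (-c) := by positivity
    have h3 : 1 - (n : ℝ) ^ (-(c / 2)) ≤
        1 - (N : ℝ) ^ s * (2 * (n : ℝ) ^ (-c)) - (n : ℝ) ^ (-(2 * c)) := by
      rw [hD] at e6; linarith
    gcongr
  -- The failure probability is at most `n ^ (-1) + n ^ (-2c)`. It improves on the input `n ^ (-c)`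
  -- by enough to be below `(2n) ^ (-c)`, so the next block can start at level `2n`.
  have hcount : ∀ y, μ.real {ω | ¬ M ≤
      ((T.ball n y).filter fun x => IsBig T (1 - 2 * ε) (conf X ω) n x).card} ≤
      ((2 * n : ℕ) : ℝ) ^ (-c) := by
    intro y
    refine (hX.real_few_isBig_le (by omega) hsn (by positivity) le_rfl
      (δ := (n : ℝ) ^ (-(2 * c))) (by positivity) hbig hMlt y).trans ?_
    have h1 : γ₀ / (n : ℝ) ^ (-(2 * c)) = (n : ℝ) ^ (-(2 * c)) := by
      rw [hγ₀, ← Real.rpow_sub hn0']; congr 1; ring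
    have h2 : 1 / ((n : ℝ) ^ (-c) * (N : ℝ) ^ n) ≤ (n : ℝ) ^ (-1 : ℝ) := by
      rw [div_le_iff₀ (by positivity)]
      have h3 : (n : ℝ) ^ 2 ≤ (N : ℝ) ^ n := by
        calc (n : ℝ) ^ 2 ≤ 2 ^ n := by exact_mod_cast sq_le_two_pow hn4
          _ ≤ (N : ℝ) ^ n := by gcongr; exact_mod_cast hN
      calc (1 : ℝ) = (n : ℝ) ^ (0 : ℝ) := (Real.rpow_zero _).symm
        _ ≤ (n : ℝ) ^ ((-1 : ℝ) + (-c + 2)) :=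
            Real.rpow_le_rpow_of_exponent_le hn1' (by rw [hc]; linarith)
        _ = (n : ℝ) ^ (-1 : ℝ) * ((n : ℝ) ^ (-c) * (n : ℝ) ^ 2) := by
            rw [Real.rpow_add hn0', Real.rpow_add hn0', Real.rpow_two]
        _ ≤ _ := by gcongr
    have h4 : ((2 * n : ℕ) : ℝ) ^ (-c) = ((2 : ℝ) ^ c)⁻¹ * (n : ℝ) ^ (-c) := by
      push_cast
      rw [Real.mul_rpow (by norm_num) hn0'.le, Real.rpow_neg (by norm_num)]
    rw [h1, h4, ← div_eq_inv_mul, le_div_iff₀ (by positivity)]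
    have h5 := mul_le_mul_of_nonneg_right h2 (by positivity : (0 : ℝ) ≤ (2 : ℝ) ^ c)
    linarith
  refine ⟨fun y => ?_, fun y x hx => ?_⟩
  · refine (measureReal_mono ?_ (measure_ne_top _ _)).trans (hcount y)
    intro ω hω h
    exact hω (isGood_of_count (by linarith) (by omega) h)
  · have h1 : μ.real {ω | ¬ IsBig T (1 - 2 * ε) (conf X ω) n x} ≤ γ := by
      rw [hγ]
      refine le_trans ?_ (add_le_add (hX.real_tainted_le s x) (hbig x))
      refine (measureReal_mono ?_ (measure_ne_top _ _)).trans (measureReal_union_le _ _)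
      intro ω hω
      by_cases h : ∀ y ∈ T.cball s x, X s(y, y) ω = true
      · exact Or.inr ⟨hω, h⟩
      · push Not at h
        obtain ⟨y, hy, h⟩ := h
        exact Or.inl ⟨y, hy, by simpa using h⟩
    have h2 : ((2 * n : ℕ) : ℝ) ^ (-c) ≤ (n : ℝ) ^ (-c) := by
      apply Real.rpow_le_rpow_of_nonpos hn0' _ (by linarith)
      push_cast; linarith
    have h3 : γ + ((2 * n : ℕ) : ℝ) ^ (-c) ≤ (n : ℝ) ^ (-(c / 2)) := by
      have h4 : (0 : ℝ) ≤ (n : ℝ) ^ (-c) := by positivity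
      have h5 : 1 ≤ D := by rw [hD]; linarith
      nlinarith
    refine le_trans ?_ ((add_le_add h1 (hcount y)).trans h3)
    refine (measureReal_mono ?_ (measure_ne_top _ _)).trans (measureReal_union_le _ _)
    intro ω hω
    by_contra hcon
    rw [Set.mem_union, not_or] at hcon
    have hc1 := not_not.1 hcon.1
    have hc2 := not_not.1 hcon.2
    exact hω (exists_core_mem (by linarith) (by omega) hM1 hx hc1 hc2)

/-! ### Iterated renormalization along doubling levels -/

section Outer

variable {V Ω : Type} {N : ℕ} [MeasurableSpace Ω] {T : HTree V N} {μ : Measure Ω}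
    {X : Sym2 V → Ω → Bool} {J : ℕ → ℝ}

/-- The percolation `X` has been renormalized to level `n`: balls of level `n` contain sets `Γ` of
density at least `κ`, whose connections are governed by a new percolation with few closed sites,
and the point `o` belongs to the set of its ball up to probability `ζ`. -/
def Renormalizes (T : HTree V N) (μ : Measure Ω) (X : Sym2 V → Ω → Bool) (J : ℕ → ℝ) (o : V)
    (n : ℕ) (p κ ζ : ℝ) : Prop :=
  ∃ (Y : Sym2 V → Ω → Bool) (Γ : Ω → V → Finset V) (M : ℕ),
    Perc T μ Y p (fun j => (M : ℝ) ^ 2 * J (n + j)) ∧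
    κ * (N : ℝ) ^ n ≤ M ∧
    (∀ ω y, Γ ω y ⊆ T.ball n y ∧ (Γ ω y).card = M) ∧
    (∀ ω B y y', Conn (conf Y ω) B y y' → ∀ a ∈ Γ ω y, ∀ b ∈ Γ ω y',
      Conn (conf X ω) (B.biUnion (T.ball n)) a b) ∧
    μ.real {ω | ¬ (Y s(o, o) ω = true ∧ o ∈ Γ ω o)} ≤ ζ

theorem up_iter_fixed {o : V} (ho : T.up o = o) (n : ℕ) : T.up^[n] o = o :=
  Function.iterate_fixed ho n

theorem mem_ball_fixed {o : V} (ho : T.up o = o) (n : ℕ) : o ∈ T.ball n o :=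
  T.mem_ball.2 (up_iter_fixed ho n)

/-- When every site and bond inside a ball is open, the whole ball is a core, of density `1`. -/
theorem renormalizes_base [IsProbabilityMeasure μ] {p q : ℝ} (hX : Perc T μ X p J) {o : V}
    (ho : T.up o = o) (n : ℕ)
    (hq : ∀ y, ∑ e ∈ (T.ball n y).sym2, μ.real {ω | X e ω = false} ≤ q) :
    Renormalizes T μ X J o n q 1 q := by
  have hball : ∀ c : Sym2 V → Bool, ∀ y, (∀ e ∈ (T.ball n y).sym2, c e = true) →
      IsCore T n (N ^ n) (Conn c (T.ball n y)) y (T.ball n y) := by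
    intro c y h
    refine ⟨subset_rfl, T.card_ball n y, fun a ha b hb => .single ⟨ha, hb, ?_, ?_, ?_⟩⟩ <;>
    exact h _ (by simp [ha, hb])
  have hle : ∀ y, μ.real {ω | ¬ ∀ e ∈ (T.ball n y).sym2, X e ω = true} ≤ q := by
    intro y
    have h1 : {ω | ¬ ∀ e ∈ (T.ball n y).sym2, X e ω = true} =
        ⋃ e ∈ (T.ball n y).sym2, {ω | X e ω = false} := by
      ext ω
      simp only [Set.mem_ofPred_eq, not_forall, Set.mem_iUnion, Bool.not_eq_true]
    rw [h1]
    exact (measureReal_biUnion_finset_le _ _).trans (hq y)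
  refine ⟨fun e ω => ren T n (N ^ n) o (conf X ω) e, fun ω => core T n (N ^ n) o (conf X ω), N ^ n,
    ?_, ?_, fun ω y => core_subset_card le_rfl y, ?_, ?_⟩
  · refine hX.renormalize le_rfl fun y => (measureReal_mono ?_ (measure_ne_top _ _)).trans (hle y)
    exact fun ω hω h => hω ⟨_, hball _ y h⟩
  · push_cast; linarith
  · intro ω B y y' h a ha b hb
    exact Conn.of_ren le_rfl h ha hb
  · refine (measureReal_mono ?_ (measure_ne_top _ _)).trans (hle o)
    intro ω hω h
    have h1 := hball _ o h
    exact hω ⟨ren_diag.2 ⟨_, h1⟩, mem_core ⟨_, h1, mem_ball_fixed ho n⟩⟩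

/-- Renormalizations compose: the new sets are unions of the old ones over the new cores, so sizes
multiply and the kernel becomes `(M' M) ^ 2 * J (2 n + j)`. As `T.up o = o`, the same `o` is the
marked site at every scale. -/
theorem Renormalizes.step [IsProbabilityMeasure μ] (hN : 0 < N) {o : V} (ho : T.up o = o) {n : ℕ}
    {p p' κ ζ δ : ℝ} (hδ0 : 0 ≤ δ) (hδ1 : δ ≤ 1) (hκ : 0 ≤ κ)
    (h : Renormalizes T μ X J o n p κ ζ)
    (hblock : ∀ (Y : Sym2 V → Ω → Bool) (M : ℕ), κ * (N : ℝ) ^ n ≤ M →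
      Perc T μ Y p (fun j => (M : ℝ) ^ 2 * J (n + j)) →
      (∀ y, μ.real {ω | ¬ IsGood T n (blockSize N n δ) (conf Y ω) y} ≤ p') ∧
      ∀ y, ∀ x ∈ T.ball n y, μ.real {ω | ¬ ∃ S, IsCore T n (blockSize N n δ)
        (Conn (conf Y ω) (T.ball n y)) y S ∧ x ∈ S} ≤ δ) :
    Renormalizes T μ X J o (2 * n) p' (κ * (1 - δ)) (ζ + δ) := by
  obtain ⟨Y, Γ, M, hY, hM, hΓ, hconn, hoζ⟩ := h
  obtain ⟨hb1, hb2⟩ := hblock Y M hM hY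
  set M' := blockSize N n δ with hM'
  have hNn : (0 : ℝ) < (N : ℝ) ^ n := by positivity
  have hM'N : M' ≤ N ^ n := by
    rw [hM', blockSize, Nat.ceil_le]
    push_cast
    nlinarith
  refine ⟨fun e ω => ren T n M' o (conf Y ω) e,
    fun ω z => (core T n M' o (conf Y ω) z).biUnion (Γ ω), M' * M, ?_, ?_, ?_, ?_, ?_⟩
  · have h1 := hY.renormalize (o := o) hM'N hb1
    have h2 : (fun j => ((M' * M : ℕ) : ℝ) ^ 2 * J (2 * n + j)) =
        fun j => (M' : ℝ) ^ 2 * ((M : ℝ) ^ 2 * J (n + (n + j))) := by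
      funext j
      have : 2 * n + j = n + (n + j) := by ring
      rw [this]; push_cast; ring
    rw [h2]; exact h1
  · have h1 : (1 - δ) * (N : ℝ) ^ n ≤ M' := Nat.le_ceil _
    have h2 : (0 : ℝ) ≤ (1 - δ) * (N : ℝ) ^ n := mul_nonneg (by linarith) hNn.le
    have h3 : (0 : ℝ) ≤ κ * (N : ℝ) ^ n := mul_nonneg hκ hNn.le
    have h4 := mul_le_mul h1 hM h3 (by positivity)
    push_cast
    refine le_trans (le_of_eq ?_) h4
    ring
  · intro ω z
    have hs := core_subset_card (T := T) (c := conf Y ω) (o := o) hM'N z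
    constructor
    · refine Finset.biUnion_subset.2 fun y hy => ?_
      rw [two_mul, ← T.ball_add]
      exact (hΓ ω y).1.trans (Finset.subset_biUnion_of_mem _ (hs.1 hy))
    · rw [Finset.card_biUnion, Finset.sum_congr rfl fun y _ => (hΓ ω y).2, Finset.sum_const, hs.2,
        smul_eq_mul]
      intro y _ y' _ hne
      exact (T.ball_disjoint hne).mono (hΓ ω y).1 (hΓ ω y').1
  · intro ω B z z' hz a ha b hb
    obtain ⟨y, hy, ha⟩ := Finset.mem_biUnion.1 ha
    obtain ⟨y', hy', hb⟩ := Finset.mem_biUnion.1 hb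
    have h1 := hconn ω _ y y' (Conn.of_ren hM'N hz hy hy') a ha b hb
    rw [Finset.biUnion_biUnion] at h1
    simpa only [T.ball_add, ← two_mul] using h1
  · refine le_trans ?_ (add_le_add hoζ (hb2 o o (mem_ball_fixed ho n)))
    refine (measureReal_mono ?_ (measure_ne_top _ _)).trans (measureReal_union_le _ _)
    intro ω hω
    by_contra hcon
    rw [Set.mem_union, not_or] at hcon
    have hc1 := not_not.1 hcon.1
    have hc2 := not_not.1 hcon.2
    refine hω ⟨ren_diag.2 ?_, Finset.mem_biUnion.2 ⟨o, mem_core hc2, hc1.2⟩⟩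
    obtain ⟨S, hS, _⟩ := hc2
    exact ⟨S, hS⟩

/-- Iterated renormalization: if the kernel is at least `a N log n / N ^ (2 l)` for `l > n ≥ n₀`
with `a > 1`, and balls of some large level are fully open with large probability, then the cluster
of `o` is large in arbitrarily large balls with probability at least `1 / 2`. -/
theorem exists_large_cluster (hN : 2 ≤ N) {a : ℝ} (ha : 1 < a) (n₁ : ℕ) :
    ∃ n₀ ≥ n₁, ∃ q > 0, ∀ (V Ω : Type) [MeasurableSpace Ω] (T : HTree V N)
      (μ : Measure Ω) [IsProbabilityMeasure μ] (X : Sym2 V → Ω → Bool) (p : ℝ) (J : ℕ → ℝ) (o : V),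
      Perc T μ X p J → T.up o = o →
      (∀ n ≥ n₀, ∀ l > n, a * Real.log n * ((N : ℝ) / (N : ℝ) ^ (2 * l)) ≤ J l) →
      (∀ y, ∑ e ∈ (T.ball n₀ y).sym2, μ.real {ω | X e ω = false} ≤ q) →
      ∀ m : ℕ, 1 / 2 ≤ μ.real {ω | (N : ℝ) ^ (2 ^ m * n₀) / 2 ≤
        (clus (conf X ω) (T.ball (2 ^ m * n₀) o) o).card} := by
  -- Core densities will stay above `1 - η`, and they enter the kernel squared.
  obtain ⟨η, hη0, hη1, hηa⟩ : ∃ η : ℝ, 0 < η ∧ η ≤ 1 / 4 ∧ 1 < a * (1 - η) ^ 2 := by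
    refine ⟨min (1 / 4) ((a - 1) / (4 * a)), lt_min (by norm_num)
      (div_pos (by linarith) (by linarith)), min_le_left _ _, ?_⟩
    set η := min (1 / 4 : ℝ) ((a - 1) / (4 * a)) with hη
    have h2 : η ≤ (a - 1) / (4 * a) := min_le_right _ _
    rw [le_div_iff₀ (by linarith)] at h2
    nlinarith [mul_nonneg (by linarith : 0 ≤ a) (sq_nonneg η)]
  obtain ⟨c, hc, nb, hblock⟩ := exists_block hN hηa
  set x : ℝ := (2 : ℝ) ^ (-(c / 2)) with hx
  have hx0 : 0 < x := by positivity
  have hx1 : x < 1 := Real.rpow_lt_one_of_one_lt_of_neg (by norm_num) (by linarith)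
  -- Large `n₀` keeps the geometric series of the losses `(2 ^ m n₀) ^ (-c/2)` below `η`.
  obtain ⟨n₀, hn₀⟩ := ((Filter.eventually_ge_atTop (max (max n₁ nb) 2)).and
    (eventually_mul_rpow_le ((1 - x)⁻¹ * η⁻¹) (a := c / 2) (b := 0) (by linarith))).exists
  obtain ⟨hn1, hn2⟩ := hn₀
  have hn2' : 2 ≤ n₀ := (le_max_right _ _).trans hn1
  have hn0 : (0 : ℝ) < n₀ := by positivity
  rw [neg_zero, Real.rpow_zero] at hn2
  refine ⟨n₀, ((le_max_left _ _).trans (le_max_left _ _)).trans hn1,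
    min (1 / 4) ((n₀ : ℝ) ^ (-c)), lt_min (by norm_num) (by positivity), ?_⟩
  intro V Ω _ T μ _ X p J o hX ho hJ hq
  set d : ℕ → ℝ := fun m => ((2 ^ m * n₀ : ℕ) : ℝ) ^ (-(c / 2)) with hd
  set A : ℕ → ℝ := fun m => ∑ l ∈ Finset.range m, d l with hA
  have hd0 : ∀ m, 0 ≤ d m := fun m => by simp only [hd]; positivity
  have hdx : ∀ m, d m = (n₀ : ℝ) ^ (-(c / 2)) * x ^ m := by
    intro m
    simp only [hd, hx]
    push_cast
    rw [Real.mul_rpow (by positivity) hn0.le, mul_comm, ← Real.rpow_natCast, ← Real.rpow_natCast,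
      ← Real.rpow_mul (by norm_num), ← Real.rpow_mul (by norm_num), mul_comm (m : ℝ)]
  have hAη : ∀ m, A m ≤ η := by
    intro m
    have h1 : ∑ l ∈ Finset.range m, x ^ l ≤ (1 - x)⁻¹ := by
      rw [← tsum_geometric_of_lt_one hx0.le hx1]
      exact (summable_geometric_of_lt_one hx0.le hx1).sum_le_tsum _ fun _ _ => by positivity
    simp only [hA, hdx, ← Finset.mul_sum]
    have h2 : (n₀ : ℝ) ^ (-(c / 2)) * ∑ l ∈ Finset.range m, x ^ l ≤
        (n₀ : ℝ) ^ (-(c / 2)) * (1 - x)⁻¹ := by gcongr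
    refine h2.trans ?_
    have h3 : (1 - x)⁻¹ * η⁻¹ * (n₀ : ℝ) ^ (-(c / 2)) =
      ((n₀ : ℝ) ^ (-(c / 2)) * (1 - x)⁻¹) / η := by ring
    rwa [h3, div_le_one hη0] at hn2
  have hmain : ∀ m, Renormalizes T μ X J o (2 ^ m * n₀) (((2 ^ m * n₀ : ℕ) : ℝ) ^ (-c))
      (1 - A m) (1 / 4 + A m) := by
    intro m
    induction m with
    | zero =>
      obtain ⟨Y, Γ, M, hY, hM, hΓ, hconn, hoζ⟩ := renormalizes_base hX ho n₀ hq
      simp only [pow_zero, one_mul, hA, Finset.range_zero, Finset.sum_empty, sub_zero, add_zero]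
      exact ⟨Y, Γ, M, ⟨hY.meas, hY.indep, fun x => (hY.site x).trans (min_le_right _ _), hY.bond⟩,
        hM, hΓ, hconn, hoζ.trans (min_le_left _ _)⟩
    | succ m ih =>
      set n := 2 ^ m * n₀ with hn
      have hnn₀ : n₀ ≤ n := Nat.le_mul_of_pos_left _ (by positivity)
      have hn1' : (1 : ℝ) < n := by exact_mod_cast (by omega : 1 < n)
      have hd1 : d m ≤ 1 := Real.rpow_le_one_of_one_le_of_nonpos hn1'.le (by linarith)
      have hκ : 0 ≤ 1 - A m := by linarith [hAη m]
      have hstep := ih.step (δ := d m) (p' := ((2 * n : ℕ) : ℝ) ^ (-c)) (by omega) ho (hd0 m) hd1 hκ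
        (fun Y M hM hY => by
          refine hblock n ((le_max_right _ _).trans ((le_max_left _ _).trans (hn1.trans hnn₀)))
            V Ω T μ Y _ hY fun j hj0 hjn => ?_
          -- Every level `n + j` of the block exceeds `n`, so the intensity `a log n` is available
          -- throughout it.
          have h1 := hJ n hnn₀ (n + j) (by omega)
          have hNn : (0 : ℝ) < (N : ℝ) ^ n := by positivity
          have hη' : (1 - η) * (N : ℝ) ^ n ≤ M := by
            refine le_trans ?_ hM
            have := hAη m
            gcongr
          have h2 : ((1 - η) * (N : ℝ) ^ n) ^ 2 ≤ (M : ℝ) ^ 2 :=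
            pow_le_pow_left₀ (mul_nonneg (by linarith) hNn.le) hη' 2
          have hlog : 0 ≤ Real.log n := Real.log_nonneg hn1'.le
          have h3 : 0 ≤ a * Real.log n * ((N : ℝ) / (N : ℝ) ^ (2 * (n + j))) := by positivity
          calc a * (1 - η) ^ 2 * Real.log n * ((N : ℝ) / (N : ℝ) ^ (2 * j)) =
                ((1 - η) * (N : ℝ) ^ n) ^ 2 *
                  (a * Real.log n * ((N : ℝ) / (N : ℝ) ^ (2 * (n + j)))) := by
                have : (N : ℝ) ^ (2 * (n + j)) = ((N : ℝ) ^ n) ^ 2 * (N : ℝ) ^ (2 * j) := by ring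
                rw [this]; field_simp
            _ ≤ (M : ℝ) ^ 2 * (a * Real.log n * ((N : ℝ) / (N : ℝ) ^ (2 * (n + j)))) := by gcongr
            _ ≤ _ := by gcongr)
      have h2n : 2 ^ (m + 1) * n₀ = 2 * n := by rw [hn]; ring
      have hAs : A (m + 1) = A m + d m := by simp only [hA, Finset.sum_range_succ]
      rw [h2n, hAs]
      obtain ⟨Y, Γ, M, hY, hM, hΓ, hconn, hoζ⟩ := hstep
      refine ⟨Y, Γ, M, hY, le_trans ?_ hM, hΓ, hconn, hoζ.trans (le_of_eq (by ring))⟩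
      have hA0 : 0 ≤ A m := Finset.sum_nonneg fun l _ => hd0 l
      gcongr
      nlinarith [mul_nonneg hA0 (hd0 m)]
  intro m
  obtain ⟨Y, Γ, M, hY, hM, hΓ, hconn, hoζ⟩ := hmain m
  set n := 2 ^ m * n₀ with hn
  set G := {ω | (N : ℝ) ^ n / 2 ≤ (clus (conf X ω) (T.ball n o) o).card} with hG
  have hGm : MeasurableSet G := by
    refine measurableSet_conf (P := fun c => (N : ℝ) ^ n / 2 ≤ (clus c (T.ball n o) o).card)
      (D := (T.ball n o).sym2) hX.meas fun c c' h => ?_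
    have : clus c (T.ball n o) o = clus c' (T.ball n o) o := by
      unfold clus
      rw [conn_congr h]
    simp only [this]
  have h1 : μ.real Gᶜ ≤ 1 / 2 := by
    refine (measureReal_mono ?_ (measure_ne_top _ _)).trans (hoζ.trans (by linarith [hAη m]))
    intro ω hω hY'
    apply hω
    have h2 : Γ ω o ⊆ clus (conf X ω) (T.ball n o) o := by
      intro b hb
      have h3 := hconn ω {o} o o (.refl (Finset.mem_singleton_self o) hY'.1) o hY'.2 b hb
      rw [Finset.singleton_biUnion] at h3
      exact mem_clus.2 h3
    have h4 : (M : ℝ) ≤ (clus (conf X ω) (T.ball n o) o).card := by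
      rw [← (hΓ ω o).2]
      exact_mod_cast Finset.card_le_card h2
    change (N : ℝ) ^ n / 2 ≤ _
    refine le_trans ?_ (hM.trans h4)
    have h5 : (0 : ℝ) < (N : ℝ) ^ n := by positivity
    nlinarith [hAη m]
  have h2 := probReal_compl_eq_one_sub hGm (μ := μ)
  linarith

end Outer

/-! ### The hierarchical lattice as a tree at infinity -/

section Lattice

variable {L d : ℕ}

/-- The shift of coordinates. -/
def shiftDown (x : HierLattice L d) : HierLattice L d :=
  x.comapDomain Nat.succ Nat.succ_injective.injOn

@[simp]
theorem shiftDown_apply (x : HierLattice L d) (i : ℕ) : shiftDown x i = x (i + 1) := rfl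

/-- The point with first coordinate `a` and shift `x`. -/
def consPoint (a : Fin d → ZMod L) (x : HierLattice L d) : HierLattice L d :=
  x.mapDomain Nat.succ + Finsupp.single 0 a

@[simp]
theorem consPoint_zero (a : Fin d → ZMod L) (x : HierLattice L d) : consPoint a x 0 = a := by
  rw [consPoint, Finsupp.add_apply, Finsupp.mapDomain_of_notMem_range _ _ (by simp)]
  simp

@[simp]
theorem consPoint_succ (a : Fin d → ZMod L) (x : HierLattice L d) (i : ℕ) :
    consPoint a x (i + 1) = x i := by
  rw [consPoint, Finsupp.add_apply]
  have := Finsupp.mapDomain_apply Nat.succ_injective x i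
  simpa using this

theorem shiftDown_iterate_apply (n : ℕ) (x : HierLattice L d) (i : ℕ) :
    shiftDown^[n] x i = x (i + n) := by
  induction n generalizing i with
  | zero => rfl
  | succ n ih => rw [Function.iterate_succ_apply', shiftDown_apply, ih]; congr 1; ring

theorem shiftDown_iterate_eq_iff {n : ℕ} {x y : HierLattice L d} :
    shiftDown^[n] x = shiftDown^[n] y ↔ ∀ i ∈ x.neLocus y, i + 1 ≤ n := by
  constructor
  · intro h i hi
    by_contra hn
    obtain ⟨k, rfl⟩ := Nat.exists_eq_add_of_le (show n ≤ i by omega)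
    rw [Finsupp.mem_neLocus, add_comm] at hi
    apply hi
    rw [← shiftDown_iterate_apply, h, shiftDown_iterate_apply]
  · intro h
    ext1 i
    rw [shiftDown_iterate_apply, shiftDown_iterate_apply]
    by_contra hne
    have := h _ (Finsupp.mem_neLocus.2 hne)
    omega

/-- The hierarchical lattice, as the boundary of a regular tree. -/
def hierTree (L d : ℕ) [NeZero L] : HTree (HierLattice L d) (L ^ d) where
  up := shiftDown
  ch y := Finset.univ.image fun a => consPoint a y
  mem_ch x y := by
    simp only [Finset.mem_image, Finset.mem_univ, true_and]
    constructor
    · rintro ⟨a, rfl⟩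
      ext1 i
      simp
    · rintro rfl
      refine ⟨x 0, ?_⟩
      ext1 i
      cases i <;> simp
  card_ch y := by
    rw [Finset.card_image_of_injective]
    · simp [ZMod.card]
    · intro a b h
      simpa using DFunLike.congr_fun h 0
  exists_meet x y := ⟨(x.neLocus y).sup fun i => i + 1,
    shiftDown_iterate_eq_iff.2 fun _ hi => Finset.le_sup (f := fun i => i + 1) hi⟩

theorem hierTree_up_zero [NeZero L] : (hierTree L d).up 0 = 0 := by
  change shiftDown 0 = 0
  ext1 i
  simp

theorem lev_hierTree [NeZero L] (x y : HierLattice L d) :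
    (hierTree L d).lev x y = (x.neLocus y).sup fun i => i + 1 := by
  refine eq_of_forall_ge_iff fun n => ?_
  rw [HTree.lev_le_iff, Finset.sup_le_iff]
  exact shiftDown_iterate_eq_iff

theorem edgeLength_mk [NeZero L] {x y : HierLattice L d} (h : ¬ (s(x, y) : Sym2 _).IsDiag) :
    edgeLength ⟨s(x, y), h⟩ = L ^ (hierTree L d).lev x y := by
  rw [lev_hierTree]
  change hierDist x y = _
  rw [hierDist, if_neg (by simpa using h)]

end Lattice

/-! ### Site-bond percolation as a family of random bits -/

section Bits

variable {V : Type}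

/-- The state of a site (for a diagonal pair) or of a bond. -/
def bitOf (e : Sym2 V) (ω : SiteBondConfig V) : Bool :=
  if h : e.IsDiag then ω.1 e.out.1 else ω.2 ⟨e, h⟩

theorem bitOf_diag (x : V) (ω : SiteBondConfig V) : bitOf s(x, x) ω = ω.1 x := by
  have h : (Quot.out s(x, x)).1 = x := by
    have := Sym2.out_fst_mem s(x, x)
    simpa using this
  rw [bitOf, dif_pos (by simp), h]

theorem bitOf_bond {e : Sym2 V} (h : ¬ e.IsDiag) (ω : SiteBondConfig V) :
    bitOf e ω = ω.2 ⟨e, h⟩ := by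
  rw [bitOf, dif_neg h]

theorem measurable_bitOf (e : Sym2 V) : Measurable (bitOf e : SiteBondConfig V → Bool) := by
  by_cases h : e.IsDiag
  · have : (bitOf e : SiteBondConfig V → Bool) = fun ω => ω.1 e.out.1 := by
      funext ω; rw [bitOf, dif_pos h]
    rw [this]
    exact (measurable_pi_apply _).comp measurable_fst
  · have : (bitOf e : SiteBondConfig V → Bool) = fun ω => ω.2 ⟨e, h⟩ := by
      funext ω; rw [bitOf, dif_neg h]
    rw [this]
    exact (measurable_pi_apply _).comp measurable_snd

instance (q : I) (J : Edge V → ℝ≥0) : IsProbabilityMeasure (siteBondMeasure q J) := by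
  unfold siteBondMeasure
  infer_instance

/-- These cylinder probabilities contain all that is needed of the measure: the marginals directly,
and independence through `iIndepFun_bits`. -/
theorem siteBondMeasure_closed (q : I) (J : Edge V → ℝ≥0) (A : Finset V) (B : Finset (Edge V)) :
    (siteBondMeasure q J).real {ω | (∀ x ∈ A, ω.1 x = false) ∧ ∀ e ∈ B, ω.2 e = false} =
      (∏ _x ∈ A, (1 - (q : ℝ))) * ∏ e ∈ B, Real.exp (-(J e : ℝ)) := by
  have h0 : {ω : SiteBondConfig V | (∀ x ∈ A, ω.1 x = false) ∧ ∀ e ∈ B, ω.2 e = false} =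
      (Set.pi A fun _ => {false}) ×ˢ (Set.pi B fun _ => {false}) := by
    ext ω
    simp [Set.mem_pi]
  have h1 : ∀ p : I, (bernoulliMeasure true false p) {false} = ENNReal.ofReal (1 - p) := by
    intro p
    rw [← ofReal_measureReal, bernoulliMeasure_real_apply p (measurableSet_singleton _)]
    simp
  rw [h0, siteBondMeasure, measureReal_prod_prod]
  simp only [measureReal_def]
  rw [Measure.infinitePi_pi _ (fun _ _ => measurableSet_singleton _),
    Measure.infinitePi_pi _ (fun _ _ => measurableSet_singleton _), ENNReal.toReal_prod,
    ENNReal.toReal_prod]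
  simp only [h1]
  congr 1
  · refine Finset.prod_congr rfl fun _ _ => ENNReal.toReal_ofReal (sub_nonneg.2 q.2.2)
  · refine Finset.prod_congr rfl fun e _ => ?_
    rw [ENNReal.toReal_ofReal (sub_nonneg.2 (openProb (J e)).2.2)]
    simp [openProb]

theorem siteBondMeasure_site (q : I) (J : Edge V → ℝ≥0) (x : V) :
    (siteBondMeasure q J).real {ω | bitOf s(x, x) ω = false} = 1 - (q : ℝ) := by
  have := siteBondMeasure_closed q J {x} ∅
  simpa [bitOf_diag] using this

theorem siteBondMeasure_bond (q : I) (J : Edge V → ℝ≥0) {e : Sym2 V} (h : ¬ e.IsDiag) :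
    (siteBondMeasure q J).real {ω | bitOf e ω = false} = Real.exp (-(J ⟨e, h⟩ : ℝ)) := by
  have := siteBondMeasure_closed q J ∅ {⟨e, h⟩}
  simpa [bitOf_bond h] using this

theorem iIndepFun_bitOf (q : I) (J : Edge V → ℝ≥0) :
    iIndepFun (bitOf : Sym2 V → SiteBondConfig V → Bool) (siteBondMeasure q J) := by
  refine iIndepFun_bits measurable_bitOf fun F => ?_
  set A : Finset V := (F.filter Sym2.IsDiag).image fun e => e.out.1 with hA
  set B : Finset (Edge V) := F.subtype fun e => ¬ e.IsDiag with hB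
  have hmk : ∀ e : Sym2 V, e.IsDiag → s(e.out.1, e.out.1) = e := by
    intro e he
    induction e using Sym2.ind with
    | _ x y =>
      obtain rfl : x = y := by simpa using he
      have := Sym2.out_fst_mem s(x, x)
      rw [show (Quot.out s(x, x)).1 = x by simpa using this]
  have h1 := siteBondMeasure_closed q J A B
  have h2 : {ω : SiteBondConfig V | (∀ x ∈ A, ω.1 x = false) ∧ ∀ e ∈ B, ω.2 e = false} =
      {ω | ∀ e ∈ F, bitOf e ω = false} := by
    ext ω
    constructor
    · rintro ⟨ha, hb⟩ e he
      by_cases h : e.IsDiag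
      · rw [bitOf, dif_pos h]
        exact ha _ (Finset.mem_image_of_mem _ (Finset.mem_filter.2 ⟨he, h⟩))
      · rw [bitOf, dif_neg h]
        exact hb _ (Finset.mem_subtype.2 he)
    · intro h
      constructor
      · intro x hx
        obtain ⟨e, he, rfl⟩ := Finset.mem_image.1 hx
        have := h e (Finset.mem_filter.1 he).1
        rwa [bitOf, dif_pos (Finset.mem_filter.1 he).2] at this
      · rintro ⟨e, he⟩ heB
        have := h e (Finset.mem_subtype.1 heB)
        rwa [bitOf, dif_neg he] at this
  rw [← h2, h1, ← Finset.prod_filter_mul_prod_filter_not F Sym2.IsDiag]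
  congr 1
  · rw [hA, Finset.prod_image]
    · refine Finset.prod_congr rfl fun e he => ?_
      rw [← hmk e (Finset.mem_filter.1 he).2, siteBondMeasure_site]
    · intro e he f hf hef
      rw [← hmk e (Finset.mem_filter.1 he).2, ← hmk f (Finset.mem_filter.1 hf).2]
      exact congrArg (fun x => s(x, x)) hef
  · rw [← Finset.subtype_map, Finset.prod_map]
    refine Finset.prod_congr rfl fun e _ => ?_
    exact (siteBondMeasure_bond q J e.2).symm

/-- A finite-volume cluster is contained in the open cluster. -/
theorem clus_subset_openCluster (ω : SiteBondConfig V) (B : Finset V) (x : V) :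
    (clus (conf bitOf ω) B x : Set V) ⊆ openCluster ω x := by
  intro y hy
  have h : Conn (conf bitOf ω) B x y := mem_clus.1 hy
  have hx : ω.1 x = true := by
    have := h.left.2
    rwa [conf, bitOf_diag] at this
  refine ⟨hx, ?_⟩
  have key : ∀ {u v}, stepIn (conf bitOf ω) B u v → (openGraph ω).Reachable u v := by
    rintro u v ⟨_, _, h1, h2, h3⟩
    by_cases huv : u = v
    · rw [huv]
    · have hd : ¬ (s(u, v) : Sym2 V).IsDiag := by simpa using huv
      rw [conf, bitOf_diag] at h1 h2
      rw [conf, bitOf_bond hd] at h3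
      exact SimpleGraph.Adj.reachable ⟨h1, h2, hd, h3⟩
  clear hy
  induction h with
  | single h => exact key h
  | tail _ h ih => exact ih.trans (key h)

/-- Infinitely many events of probability bounded below occur simultaneously with positive
probability. -/
theorem pos_of_frequently {Ω : Type} [MeasurableSpace Ω] {μ : Measure Ω} [IsProbabilityMeasure μ]
    {E : ℕ → Set Ω} (hE : ∀ m, MeasurableSet (E m)) {δ : ℝ} (hδ : 0 < δ)
    (h : ∀ m, δ ≤ μ.real (E m)) : 0 < μ {ω | ∀ m, ∃ l ≥ m, ω ∈ E l} := by
  set U : ℕ → Set Ω := fun m => ⋃ l ≥ m, E l with hU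
  have h1 : {ω | ∀ m, ∃ l ≥ m, ω ∈ E l} = ⋂ m, U m := by
    ext ω
    simp [hU]
  have hUm : ∀ m, MeasurableSet (U m) := fun m =>
    MeasurableSet.iUnion fun l => MeasurableSet.iUnion fun _ => hE l
  have hanti : Antitone U := fun m n hmn =>
    Set.biUnion_subset_biUnion_left fun l hl => le_trans hmn hl
  have h2 := tendsto_measure_iInter_atTop (μ := μ) (fun m => (hUm m).nullMeasurableSet) hanti
    ⟨0, measure_ne_top _ _⟩
  rw [h1]
  refine lt_of_lt_of_le (ENNReal.ofReal_pos.2 hδ) (ge_of_tendsto' h2 fun m => ?_)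
  calc ENNReal.ofReal δ ≤ ENNReal.ofReal (μ.real (E m)) := ENNReal.ofReal_le_ofReal (h m)
    _ = μ (E m) := ofReal_measureReal
    _ ≤ μ (U m) := measure_mono (Set.subset_biUnion_of_mem (u := E) (le_refl m))

end Bits

end

/-! ### Comparison of the iterated logarithm with the level -/

section LogLog

/-- For `l > n`, `log log (L ^ l) = log l + log log L ≥ log n + log log 2`. The gap `a - b` absorbs
the negative constant for large `n`, uniformly in `L`. -/
theorem eventually_mul_log_le {a b : ℝ} (hb : 0 < b) (hab : b < a) :
    ∃ n₁ : ℕ, ∀ L ≥ 2, ∀ n ≥ n₁, ∀ l > n,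
      b * Real.log n ≤ a * Real.log (Real.log ((L ^ l : ℕ) : ℝ)) := by
  have ha : 0 < a := hb.trans hab
  have h := (Real.tendsto_log_atTop.comp tendsto_natCast_atTop_atTop).eventually_ge_atTop
    (-(a * Real.log (Real.log 2)) / (a - b))
  obtain ⟨n₁, hn₁⟩ := Filter.eventually_atTop.1 h
  refine ⟨max n₁ 1, fun L hL n hn l hl => ?_⟩
  have h1 := hn₁ n ((le_max_left _ _).trans hn)
  have hn0 : 0 < (n : ℝ) := by exact_mod_cast (le_max_right _ _).trans hn
  rw [Function.comp_apply, div_le_iff₀ (sub_pos.2 hab)] at h1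
  have hlog2 : 0 < Real.log 2 := Real.log_pos (by norm_num)
  have h2 : (n : ℝ) * Real.log 2 ≤ Real.log ((L ^ l : ℕ) : ℝ) := by
    rw [Nat.cast_pow, Real.log_pow]
    have hL' : (2 : ℝ) ≤ L := by exact_mod_cast hL
    gcongr
  have h3 := Real.log_le_log (by positivity) h2
  rw [Real.log_mul hn0.ne' hlog2.ne'] at h3
  nlinarith

end LogLog

/-! ### Choice of parameters and conclusion -/

theorem theorem1p4 (L d : ℕ) (hL : 2 ≤ L) (hd : 1 ≤ d) (a : ℝ) (ha : 1 < a) :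
    ∃ (q : I) (N₀ N₁ : ℕ), 0 < q ∧ q < 1 ∧ 1 ≤ N₀ ∧ 1 ≤ N₁ ∧
      ∃ J : Edge (HierLattice L d) → ℝ≥0,
        (∀ e : Edge (HierLattice L d), (J e : ℝ) =
          if N₁ ≤ edgeLength e then
            a * (L : ℝ) ^ d * Real.log (Real.log (edgeLength e : ℝ)) /
              (edgeLength e : ℝ) ^ (2 * d)
          else (N₀ : ℝ)) ∧
        0 < siteBondMeasure q J {ω | (openCluster ω (0 : HierLattice L d)).Infinite} := by
  have : NeZero L := ⟨by omega⟩
  have hN : 2 ≤ L ^ d := hL.trans (Nat.le_self_pow (by omega) L)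
  obtain ⟨b, hb, hba⟩ := exists_between ha
  obtain ⟨n₁, hn₁⟩ := eventually_mul_log_le (zero_lt_one.trans hb) hba
  obtain ⟨n₀, hn₀, r, hr, hmain⟩ := exists_large_cluster hN hb (max n₁ 1)
  obtain ⟨hn₀1, hn₀2⟩ := max_le_iff.1 hn₀
  -- The number of sites and bonds of an `n₀`-ball, that is, of unordered pairs with the diagonal;
  -- each will be closed with probability at most `ε`.
  set C : ℕ := ((L ^ d) ^ n₀ + 1).choose 2 with hC
  obtain ⟨ε, hε0, hε1, hεC⟩ : ∃ ε : ℝ, 0 < ε ∧ ε < 1 ∧ C * ε ≤ r := by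
    refine ⟨min (r / (C + 1)) (1 / 2), by positivity,
      (min_le_right _ _).trans_lt (by norm_num), ?_⟩
    have h1 : (0 : ℝ) < C + 1 := by positivity
    calc (C : ℝ) * min (r / (C + 1)) (1 / 2) ≤ (C + 1) * (r / (C + 1)) := by
          gcongr
          · linarith
          · exact min_le_left _ _
      _ = r := by field_simp
  obtain ⟨N₀, hN₀, hN₀ε⟩ : ∃ N₀ : ℕ, 1 ≤ N₀ ∧ Real.exp (-(N₀ : ℝ)) ≤ ε := by
    obtain ⟨k, hk⟩ := exists_nat_gt (-Real.log ε)
    refine ⟨max k 1, le_max_right _ _, ?_⟩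
    rw [← Real.le_log_iff_exp_le hε0]
    have : (k : ℝ) ≤ (max k 1 : ℕ) := by exact_mod_cast le_max_left _ _
    linarith
  set q : I := ⟨1 - ε, by linarith, by linarith⟩ with hq
  -- With `N₁ = L ^ (n₀ + 1)`, exactly the bonds of level at most `n₀` receive the constant `N₀`.
  set Jl : ℕ → ℝ := fun s => if L ^ (n₀ + 1) ≤ s then
    a * (L : ℝ) ^ d * Real.log (Real.log (s : ℝ)) / (s : ℝ) ^ (2 * d) else (N₀ : ℝ) with hJl
  -- Beyond the threshold, `a log log |e| ≥ b log n₀ ≥ 0`, so `Real.toNNReal` does not alter the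
  -- kernel.
  have hJ0 : ∀ l, 0 ≤ Jl (L ^ l) := by
    intro l
    simp only [hJl]
    split_ifs with h
    · have hl : n₀ < l := (Nat.pow_le_pow_iff_right (by omega)).1 h
      have h1 := hn₁ L hL n₀ hn₀1 l hl
      have h2 : 0 ≤ Real.log n₀ := Real.log_natCast_nonneg n₀
      have h3 : 0 ≤ a * Real.log (Real.log ((L ^ l : ℕ) : ℝ)) :=
        le_trans (mul_nonneg (by linarith) h2) h1
      rw [mul_right_comm]
      positivity
    · positivity
  refine ⟨q, N₀, L ^ (n₀ + 1), ?_, ?_, hN₀, Nat.one_le_pow _ _ (by omega),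
    fun e => (Jl (edgeLength e)).toNNReal, ?_, ?_⟩
  · exact Subtype.mk_lt_mk.2 (by linarith)
  · exact Subtype.mk_lt_mk.2 (by linarith)
  · rintro ⟨e, he⟩
    induction e using Sym2.ind with
    | _ x y =>
      beta_reduce
      rw [edgeLength_mk he, Real.coe_toNNReal _ (hJ0 _)]
  set J : Edge (HierLattice L d) → ℝ≥0 := fun e => (Jl (edgeLength e)).toNNReal with hJ
  have hbond : ∀ x y : HierLattice L d, x ≠ y →
      (siteBondMeasure q J).real {ω | bitOf s(x, y) ω = false} =
        Real.exp (-Jl (L ^ (hierTree L d).lev x y)) := by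
    intro x y hxy
    have he : ¬ (s(x, y) : Sym2 _).IsDiag := by simpa using hxy
    rw [siteBondMeasure_bond q J he]
    simp only [hJ]
    rw [edgeLength_mk he, Real.coe_toNNReal _ (hJ0 _)]
  have hsite : ∀ x : HierLattice L d,
      (siteBondMeasure q J).real {ω | bitOf s(x, x) ω = false} = ε := by
    intro x
    rw [siteBondMeasure_site, hq]
    simp
  have hX : Perc (hierTree L d) (siteBondMeasure q J) bitOf ε (fun l => Jl (L ^ l)) :=
    ⟨measurable_bitOf, iIndepFun_bitOf q J, fun x => (hsite x).le, hbond⟩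
  have hkey := hmain (HierLattice L d) _ (hierTree L d) _ bitOf ε _ 0 hX hierTree_up_zero ?_ ?_
  · set E : ℕ → Set (SiteBondConfig (HierLattice L d)) := fun m =>
      {ω | ((L ^ d : ℕ) : ℝ) ^ (2 ^ m * n₀) / 2 ≤
        (clus (conf bitOf ω) ((hierTree L d).ball (2 ^ m * n₀) 0) 0).card} with hE
    have hEm : ∀ m, MeasurableSet (E m) := by
      intro m
      refine measurableSet_conf (D := ((hierTree L d).ball (2 ^ m * n₀) 0).sym2)
        (P := fun c => ((L ^ d : ℕ) : ℝ) ^ (2 ^ m * n₀) / 2 ≤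
          (clus c ((hierTree L d).ball (2 ^ m * n₀) 0) 0).card) measurable_bitOf
        fun c c' h => ?_
      have : clus c ((hierTree L d).ball (2 ^ m * n₀) 0) 0 =
          clus c' ((hierTree L d).ball (2 ^ m * n₀) 0) 0 := by
        unfold clus
        rw [conn_congr h]
      simp only [this]
    -- The events `E m` need not be nested, so the argument uses their limsup: on it the origin has
    -- clusters of unbounded size, which excludes a finite one.
    refine (pos_of_frequently hEm one_half_pos hkey).trans_le (measure_mono fun ω hω hfin => ?_)
    obtain ⟨k, hk⟩ := exists_nat_gt (2 * (hfin.toFinset.card : ℝ))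
    obtain ⟨l, hl, hlE⟩ := hω k
    have h1 : clus (conf bitOf ω) ((hierTree L d).ball (2 ^ l * n₀) 0) 0 ⊆ hfin.toFinset := by
      intro y hy
      exact hfin.mem_toFinset.2 (clus_subset_openCluster ω _ _ hy)
    have h2 : ((clus (conf bitOf ω) ((hierTree L d).ball (2 ^ l * n₀) 0) 0).card : ℝ) ≤
        hfin.toFinset.card := by exact_mod_cast Finset.card_le_card h1
    have h3 : k ≤ (L ^ d) ^ (2 ^ l * n₀) := by
      have h4 : 2 ^ l ≤ 2 ^ l * n₀ := Nat.le_mul_of_pos_right _ hn₀2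
      have h5 : l < 2 ^ l := Nat.lt_two_pow_self
      have h6 := Nat.lt_pow_self (n := 2 ^ l * n₀) (show 1 < L ^ d by omega)
      omega
    have h7 : (k : ℝ) ≤ ((L ^ d : ℕ) : ℝ) ^ (2 ^ l * n₀) := by exact_mod_cast h3
    have h8 : ((L ^ d : ℕ) : ℝ) ^ (2 ^ l * n₀) / 2 ≤
      (clus (conf bitOf ω) ((hierTree L d).ball (2 ^ l * n₀) 0) 0).card := hlE
    linarith
  · intro n hn l hl
    have h1 : L ^ (n₀ + 1) ≤ L ^ l := Nat.pow_le_pow_right (by omega) (by omega)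
    have h2 := hn₁ L hL n (hn₀1.trans hn) l hl
    simp only [hJl, if_pos h1]
    have h3 : (((L ^ l : ℕ) : ℝ)) ^ (2 * d) = ((L ^ d : ℕ) : ℝ) ^ (2 * l) := by
      push_cast
      rw [← pow_mul, ← pow_mul]
      congr 1
      ring
    rw [h3, ← Nat.cast_pow L d, mul_right_comm a, mul_div_assoc]
    gcongr
  · intro y
    calc _ ≤ ∑ _e ∈ ((hierTree L d).ball n₀ y).sym2, ε := Finset.sum_le_sum fun e he => ?_
      _ = C * ε := by
        rw [Finset.sum_const, nsmul_eq_mul, Finset.card_sym2, HTree.card_ball]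
      _ ≤ r := hεC
    induction e using Sym2.ind with
    | _ u v =>
      rw [Finset.mk_mem_sym2_iff, HTree.mem_ball, HTree.mem_ball] at he
      by_cases huv : u = v
      · rw [huv, hsite]
      · rw [hbond u v huv]
        have h1 : (hierTree L d).lev u v ≤ n₀ :=
          (hierTree L d).lev_le_iff.2 (he.1.trans he.2.symm)
        have h2 : ¬ L ^ (n₀ + 1) ≤ L ^ (hierTree L d).lev u v := by
          rw [Nat.pow_le_pow_iff_right (by omega)]
          omega
        simp only [hJl, if_neg h2]
        exact hN₀ε
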